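/- Consider the plant $\dot x=Ax+Bu+Dv$ with $x(t)\in\mathbb R^n$, $u(t)\in\mathbb R$, tracking error $e=Cx+Fv\in\mathbb R$, and the exosystem $\dot v=Sv$ with $v(t)\in\mathbb R^q$. Assume that $(A,B)$ is controllable and that $\operatorname{rank}\begin{bmatrix}A-\lambda I&B\\ C&0\end{bmatrix}=n+1$ for every eigenvalue $\lambda$ of $S$. **Attacks.** Denial-of-service (DoS) attacks occupy a set $\mathcal I=\bigcup_{l\ge0}[h_l,h_l+\tau_l)$ with $h_l,\tau_l\ge 0$. Let $n(t_a,t_b)$ be the number of times in $[t_a,t_b]$ at which the attack status changes (from off to on or from on to off). Assume that there are constants $\eta>1$, $\tau_D>0$, $\kappa>0$, $T>1$ such that for all $t_b>t_a\ge0$ $$n(t_a,t_b)\le\eta+\frac{t_b-t_a}{\tau_D},\qquad |(t_a,t_b)\cap\mathcal I|\le\kappa+\frac{t_b-t_a}{T},$$ where $|\cdot|$ is Lebesgue measure. **Data.** Let $x,u,v$ be signals recorded on intervals $[t_{2j},t_{2j+1}]$, $0\le j\le s$, with $0\le t_0<t_1<\cdots$, on which plant and exosystem equations hold and $u$ is essentially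 bounded. Let $\operatorname{vecv}(a)=(a_ia_j)_{i\le j}$; for symmetric $P$ let $\operatorname{vecs}(P)$ list the $p_{ij}$, $i\le j$, with the off-diagonal entries doubled; let $\operatorname{vec}$ stack columns. For signals $a,b$ let $\delta_a,\Lambda_a,\Gamma_{a,b}$ be the matrices with $j$-th rows $\operatorname{vecv}(a(t_{2j+1}))-\operatorname{vecv}(a(t_{2j}))$, $\int_{t_{2j}}^{t_{2j+1}}\operatorname{vecv}(a)\,d\tau$ and $\int_{t_{2j}}^{t_{2j+1}}a\otimes b\,d\tau$ (transposed). Let $X_0=0$, $CX_1=-F$, and let $\operatorname{vec}(X_2),\dots,\operatorname{vec}(X_{(n-1)q+1})$ be a basis of $\ker(I_q\otimes C)$; put $x_i=x-X_iv$. Assume $\operatorname{rank}[\Gamma_{x_i,x_i},\Gamma_{x_i,u},\Gamma_{x_i,v}]=\frac{n(n+1)}2+(1+q)n$ for $0\le i\le(n-1)q+1$. **Learned controller.** 1. Let $\lambda^+>0$ and $\epsilon>0$ be such that $\Psi=[\delta_x-2\lambda^+\Lambda_x,\,-2\Gamma_{x,u},\,-2\Gamma_{x,v}]$ has full column rank and,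 for some $Y_1,Y_2$ and a symmetric positive definite $P^+$, $\Psi\,[\operatorname{vecs}(P^+);Y_1;Y_2]=-\epsilon\,\Gamma_{x,x}\operatorname{vec}(I)$. (Given the rank condition on the data, this says that $A-\lambda^+I$ is Hurwitz and $(A-\lambda^+I)^TP^++P^+(A-\lambda^+I)=-\epsilon I$.) 2. Put $\lambda^-=\frac{2\lambda^+}{T-1}$ and let $Q\succ0$. Let $K_0$ be admissible: $A-BK_0$ is Hurwitz and $\int_0^\infty e^{2\lambda^-t}\big(\xi^TQ\xi+(K_0\xi)^2\big)dt<\infty$ along all solutions of $\dot\xi=(A-BK_0)\xi$. With $$\Psi_{ik}=[\delta_{x_i}+2\lambda^-\Lambda_{x_i},\,-2\Gamma_{x_i,x_i}(I\otimes K_k^T)-2\Gamma_{x_i,u},\,-2\Gamma_{x_i,v}],\qquad \Phi_{ik}=-\Gamma_{x_i,x_i}\operatorname{vec}(Q+K_k^TK_k),$$ let, for $k=0,\dots,k^*$, the symmetric matrix $P_k$ and the gain $K_{k+1}$ be obtained from a solution of $\Psi_{0k}[\operatorname{vecs}(P_k);\operatorname{vec}(K_{k+1});Z]=\Phi_{0k}$.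 (Given the rank condition, this is the policy iteration $0=A_k^TP_k+P_kA_k+Q+K_k^TK_k+2\lambda^-P_k$, $K_{k+1}=B^TP_k$, with $A_k=A-BK_k$.) 3. Let $\hat B,\hat D,\hat S_i$ satisfy $K_{k^*+1}=\hat B^TP_{k^*}$, $\hat S_0=0$ and $\Psi_{ik^*}[\operatorname{vecs}(P_{k^*});\operatorname{vec}(K_{k^*+1});\operatorname{vec}((\hat D-\hat S_i)^TP_{k^*})]=\Phi_{ik^*}$ for $0\le i\le(n-1)q+1$. Let $X=X_1+\sum_{i\ge2}\alpha_iX_i$ and $U$ satisfy $\hat S_1+\sum_{i\ge2}\alpha_i\hat S_i=\hat BU+\hat D$. (Given the rank condition, this means $XS=AX+BU+D$ and $0=CX+F$.) Let $0<k\le k^*$, $L_k=K_kX+U$, and let the controller be $u=-K_kx+L_kv$ for $t\notin\mathcal I$ and $u=Uv$ for $t\in\mathcal I$. With $\lambda_M,\lambda_m$ the largest and smallest eigenvalue, suppose $$\tau_D\ \ge\ \log\left(\frac{\lambda_M(P_k)\,\lambda_M(P^+)}{\lambda_m(P_k)\,\lambda_m(P^+)}\right)\frac{T}{2(T-1)\lambda^-}.$$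 **Conclusion.** The closed loop achieves output regulation: for $v\equiv0$ the origin is exponentially stable, and $e(t)\to0$ for all $x(0),v(0)$. Moreover there are $c,\alpha>0$ such that $|x(t)-Xv(t)|\le c\,e^{-\alpha(t-t_0)}|x(t_0)-Xv(t_0)|$ for all $t\ge t_0\ge0$ and all closed-loop trajectories. -/

import Mathlib

open MeasureTheory Set Filter Topology Matrix
open scoped Kronecker

namespace ResilientRegulation

noncomputable section

/-! ### Matrices -/

/-- All eigenvalues of the real matrix `M` lie in the open left half plane. -/
def IsHurwitz {n : ℕ} (M : Matrix (Fin n) (Fin n) ℝ) : Prop :=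
  ∀ μ ∈ spectrum ℂ (M.map (algebraMap ℝ ℂ)), μ.re < 0

/-- The pair `(A, B)` is controllable: the matrix `[B, A B, ..., A ^ (n - 1) B]` has rank `n`. -/
def IsControllable {n m : ℕ} (A : Matrix (Fin n) (Fin n) ℝ) (B : Matrix (Fin n) (Fin m) ℝ) : Prop :=
  (Matrix.of fun (i : Fin n) (j : Fin n × Fin m) => (A ^ (j.1 : ℕ) * B) i j.2).rank = n

/-- The largest eigenvalue of a real symmetric matrix. -/
def lambdaMax {n : ℕ} (M : Matrix (Fin n) (Fin n) ℝ) : ℝ := sSup (spectrum ℝ M)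

/-- The smallest eigenvalue of a real symmetric matrix. -/
def lambdaMin {n : ℕ} (M : Matrix (Fin n) (Fin n) ℝ) : ℝ := sInf (spectrum ℝ M)

/-- The Euclidean norm on `ℝⁿ`. -/
def euclNorm {n : ℕ} (x : Fin n → ℝ) : ℝ := Real.sqrt (∑ i, x i ^ 2)

/-! ### Plant, exosystem and output regulation -/

/-- The data of the plant `x' = A x + B u + D v` with scalar input and tracking error
`e = C x + F v`, and of the exosystem `v' = S v`. -/
structure Plant (n q : ℕ) where
  A : Matrix (Fin n) (Fin n) ℝ
  B : Matrix (Fin n) (Fin 1) ℝ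
  C : Matrix (Fin 1) (Fin n) ℝ
  D : Matrix (Fin n) (Fin q) ℝ
  F : Matrix (Fin 1) (Fin q) ℝ
  S : Matrix (Fin q) (Fin q) ℝ

namespace Plant

variable {n q : ℕ} (p : Plant n q)

/-- The matrix `[A - λ I, B; C, 0]` has rank `n + 1` for every eigenvalue `λ` of `S`. -/
def RegulatorRankCondition : Prop :=
  ∀ μ ∈ spectrum ℂ (p.S.map (algebraMap ℝ ℂ)),
    (Matrix.fromBlocks (p.A.map (algebraMap ℝ ℂ) - μ • 1) (p.B.map (algebraMap ℝ ℂ))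
      (p.C.map (algebraMap ℝ ℂ)) 0).rank = n + 1

/-- `v` solves the exosystem on `[0, ∞)`. -/
def IsExoTrajectory (v : ℝ → Fin q → ℝ) : Prop :=
  ∀ t, 0 ≤ t → HasDerivWithinAt v (p.S *ᵥ v t) (Ici 0) t

/-- `x` is a (Carathéodory) solution of `x' = A x + B u + D v` on `[a, b]`. -/
def IsTrajectoryOn (x : ℝ → Fin n → ℝ) (u : ℝ → Fin 1 → ℝ) (v : ℝ → Fin q → ℝ) (a b : ℝ) : Prop :=
  ContinuousOn x (Icc a b) ∧ IntervalIntegrable u volume a b ∧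
    ∀ t ∈ Icc a b, x t = x a + ∫ s in a..t, (p.A *ᵥ x s + p.B *ᵥ u s + p.D *ᵥ v s)

/-- `(x, v)` is a trajectory, on `[0, ∞)`, of plant and exosystem in closed loop with the
time-varying control law `u(t) = φ t (x t) (v t)`. -/
def IsClosedLoop (φ : ℝ → (Fin n → ℝ) → (Fin q → ℝ) → Fin 1 → ℝ)
    (x : ℝ → Fin n → ℝ) (v : ℝ → Fin q → ℝ) : Prop :=
  p.IsExoTrajectory v ∧
    ∀ b, 0 ≤ b → p.IsTrajectoryOn x (fun t => φ t (x t) (v t)) v 0 b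

/-- Output regulation: for `v ≡ 0` the origin is exponentially stable (uniformly in the initial
time), and the tracking error tends to zero for all initial conditions `x 0` and `v 0`. -/
def AchievesOutputRegulation (φ : ℝ → (Fin n → ℝ) → (Fin q → ℝ) → Fin 1 → ℝ) : Prop :=
  (∃ c > 0, ∃ α > 0, ∀ x : ℝ → Fin n → ℝ, p.IsClosedLoop φ x (fun _ => 0) →
      ∀ t₀ t, 0 ≤ t₀ → t₀ ≤ t →
        euclNorm (x t) ≤ c * Real.exp (-α * (t - t₀)) * euclNorm (x t₀)) ∧
    ∀ (x : ℝ → Fin n → ℝ) (v : ℝ → Fin q → ℝ), p.IsClosedLoop φ x v →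
      Tendsto (fun t => p.C *ᵥ x t + p.F *ᵥ v t) atTop (𝓝 0)

/-- The gain `K₀` is admissible for the cost with weight `Q` and convergence rate `r`: it is
stabilizing, and the cost `∫₀^∞ e ^ (2 r t) (ξᵀ Q ξ + w²)`, `w = - K₀ ξ`, is finite along every
trajectory of `ξ' = A ξ + B w`. -/
def IsAdmissible (Q : Matrix (Fin n) (Fin n) ℝ) (r : ℝ) (K₀ : Matrix (Fin 1) (Fin n) ℝ) : Prop :=
  IsHurwitz (p.A - p.B * K₀) ∧
    ∀ ξ : ℝ → Fin n → ℝ,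
      (∀ t, 0 ≤ t → HasDerivWithinAt ξ ((p.A - p.B * K₀) *ᵥ ξ t) (Ici 0) t) →
      IntegrableOn (fun t => Real.exp (2 * t * r) *
        (ξ t ⬝ᵥ (Q *ᵥ ξ t) + (K₀ *ᵥ ξ t) ⬝ᵥ (K₀ *ᵥ ξ t))) (Ioi 0) volume

end Plant

/-! ### Denial-of-service attacks -/

/-- A sequence of attacks: the `l`-th one occupies `[start l, start l + len l)`; a zero length means
that there is no such attack. -/
structure DoSAttack where
  start : ℕ → ℝ
  len : ℕ → ℝ
  start_nonneg : ∀ l, 0 ≤ start l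
  len_nonneg : ∀ l, 0 ≤ len l

namespace DoSAttack

variable (a : DoSAttack)

/-- The set of times at which the communication is denied. -/
def denied : Set ℝ := ⋃ l, Ico (a.start l) (a.start l + a.len l)

/-- The times in `[ta, tb]` at which the attack status changes (off to on, or on to off). -/
def transitions (ta tb : ℝ) : Set ℝ := Icc ta tb ∩ frontier a.denied

/-- The number of transitions in `[ta, tb]` is at most `η + (tb - ta) / τD`. -/
def FrequencyBound (η τD : ℝ) : Prop :=
  ∀ ta tb, 0 ≤ ta → ta < tb →
    (a.transitions ta tb).Finite ∧ ((a.transitions ta tb).ncard : ℝ) ≤ η + (tb - ta) / τD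

/-- The total time under attack during `[ta, tb]` is at most `κ + (tb - ta) / T`. -/
def DurationBound (κ T : ℝ) : Prop :=
  ∀ ta tb, 0 ≤ ta → ta < tb →
    volume.real (Ioo ta tb ∩ a.denied) ≤ κ + (tb - ta) / T

open Classical in
/-- The switched control law: `- K x + L v` under normal communication, `U v` under attack. -/
def controlLaw {n q : ℕ} (K : Matrix (Fin 1) (Fin n) ℝ) (L U : Matrix (Fin 1) (Fin q) ℝ) :
    ℝ → (Fin n → ℝ) → (Fin q → ℝ) → Fin 1 → ℝ :=
  fun t x v => if t ∈ a.denied then U *ᵥ v else -(K *ᵥ x) + L *ᵥ v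

end DoSAttack

/-! ### Learning from data -/

/-- Index set of the entries on and above the diagonal of an `n × n` matrix. -/
abbrev UpperIndex (n : ℕ) : Type := {ij : Fin n × Fin n // ij.1 ≤ ij.2}

/-- `vecv x` lists the products `x i * x j` with `i ≤ j`. -/
def vecv {n : ℕ} (x : Fin n → ℝ) : UpperIndex n → ℝ := fun ij => x ij.1.1 * x ij.1.2

/-- `vecs P` lists the entries of `P` on and above the diagonal, the off-diagonal ones doubled. -/
def vecs {n : ℕ} (P : Matrix (Fin n) (Fin n) ℝ) : UpperIndex n → ℝ :=
  fun ij => if ij.1.1 = ij.1.2 then P ij.1.1 ij.1.2 else 2 * P ij.1.1 ij.1.2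

/-- Recorded signals: state, input and exostate, to be used on the time intervals
`[t (2 j), t (2 j + 1)]`, `j = 0, ..., s`. -/
structure Experiment (n q : ℕ) where
  s : ℕ
  t : ℕ → ℝ
  x : ℝ → Fin n → ℝ
  u : ℝ → Fin 1 → ℝ
  v : ℝ → Fin q → ℝ

namespace Experiment

variable {n q : ℕ} (d : Experiment n q)

/-- The signals were generated by the plant `p`: on each recording interval the (essentially
bounded) input `u` is applied to the plant, without interruption. -/
def IsGeneratedBy (p : Plant n q) : Prop :=
  0 ≤ d.t 0 ∧ StrictMono d.t ∧ p.IsExoTrajectory d.v ∧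
    ∀ j ≤ d.s,
      MemLp d.u ⊤ (volume.restrict (Icc (d.t (2 * j)) (d.t (2 * j + 1)))) ∧
      p.IsTrajectoryOn d.x d.u d.v (d.t (2 * j)) (d.t (2 * j + 1))

/-- The shifted state `x - Y v`. -/
def shifted (Y : Matrix (Fin n) (Fin q) ℝ) : ℝ → Fin n → ℝ := fun τ => d.x τ - Y *ᵥ d.v τ

/-- The data matrix `δ_a`: increments of `vecv a` over the recording intervals. -/
def delta {k : ℕ} (a : ℝ → Fin k → ℝ) : Matrix (Fin (d.s + 1)) (UpperIndex k) ℝ :=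
  Matrix.of fun j ij => vecv (a (d.t (2 * j + 1))) ij - vecv (a (d.t (2 * j))) ij

/-- The data matrix `Γ_{a,b}`: integrals of `a ⊗ b` over the recording intervals. -/
def Gam {k m : ℕ} (a : ℝ → Fin k → ℝ) (b : ℝ → Fin m → ℝ) :
    Matrix (Fin (d.s + 1)) (Fin k × Fin m) ℝ :=
  Matrix.of fun j il => ∫ τ in (d.t (2 * j))..(d.t (2 * j + 1)), a τ il.1 * b τ il.2

/-- The data matrix `Λ_a`: integrals of `vecv a` over the recording intervals. -/
def Lam {k : ℕ} (a : ℝ → Fin k → ℝ) : Matrix (Fin (d.s + 1)) (UpperIndex k) ℝ :=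
  Matrix.of fun j ij => ∫ τ in (d.t (2 * j))..(d.t (2 * j + 1)), vecv (a τ) ij

/-- The data for the shifted state `x - Y v` are rich:
`rank [Γ_{y,y}, Γ_{y,u}, Γ_{y,v}] = n (n + 1) / 2 + (1 + q) n` with `y = x - Y v`. -/
def IsRichFor (Y : Matrix (Fin n) (Fin q) ℝ) : Prop :=
  (fromCols (fromCols (d.Gam (d.shifted Y) (d.shifted Y)) (d.Gam (d.shifted Y) d.u))
    (d.Gam (d.shifted Y) d.v)).rank = (n + 1) * n / 2 + (1 + q) * n

/-- Column index of the regression matrices. -/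
abbrev RegIndex (n q : ℕ) : Type := (UpperIndex n ⊕ (Fin n × Fin 1)) ⊕ (Fin n × Fin q)

/-- The vector of unknowns `[vecs P; vec G; vec Z]`. -/
def unknowns (P : Matrix (Fin n) (Fin n) ℝ) (G : Matrix (Fin 1) (Fin n) ℝ)
    (Z : Matrix (Fin q) (Fin n) ℝ) : RegIndex n q → ℝ :=
  Sum.elim (Sum.elim (vecs P) (vec G)) (vec Z)

/-- Regression matrix `[δ_x - 2 λ⁺ Λ_x, -2 Γ_{x,u}, -2 Γ_{x,v}]` of the first phase. -/
def Psi (lamP : ℝ) : Matrix (Fin (d.s + 1)) (RegIndex n q) ℝ :=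
  fromCols (fromCols (d.delta d.x - (2 * lamP) • d.Lam d.x) ((-2 : ℝ) • d.Gam d.x d.u))
    ((-2 : ℝ) • d.Gam d.x d.v)

/-- Right-hand side `- ε Γ_{x,x} vec I` of the first phase. -/
def Phi (ε : ℝ) : Fin (d.s + 1) → ℝ :=
  -(ε • (d.Gam d.x d.x *ᵥ vec (1 : Matrix (Fin n) (Fin n) ℝ)))

/-- Regression matrix `[δ_y + 2 λ⁻ Λ_y, -2 Γ_{y,y} (I ⊗ Kᵀ) - 2 Γ_{y,u}, -2 Γ_{y,v}]` of the second
phase, with `y = x - Y v` and the current gain `K`. -/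
def PsiPI (lamM : ℝ) (Y : Matrix (Fin n) (Fin q) ℝ) (K : Matrix (Fin 1) (Fin n) ℝ) :
    Matrix (Fin (d.s + 1)) (RegIndex n q) ℝ :=
  fromCols
    (fromCols (d.delta (d.shifted Y) + (2 * lamM) • d.Lam (d.shifted Y))
      ((-2 : ℝ) • (d.Gam (d.shifted Y) (d.shifted Y) * ((1 : Matrix (Fin n) (Fin n) ℝ) ⊗ₖ Kᵀ))
        - (2 : ℝ) • d.Gam (d.shifted Y) d.u))
    ((-2 : ℝ) • d.Gam (d.shifted Y) d.v)

/-- Right-hand side `- Γ_{y,y} vec (Q + Kᵀ K)` of the second phase. -/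
def PhiPI (Q : Matrix (Fin n) (Fin n) ℝ) (Y : Matrix (Fin n) (Fin q) ℝ)
    (K : Matrix (Fin 1) (Fin n) ℝ) : Fin (d.s + 1) → ℝ :=
  -(d.Gam (d.shifted Y) (d.shifted Y) *ᵥ vec (Q + Kᵀ * K))

end Experiment

variable {n q : ℕ}

/-- Trial matrices `X₀ = 0`, `C X₁ = -F`, and `X₂, ..., X_{(n-1)q+1}` whose vectorizations are a
basis of the kernel of `I ⊗ C`. -/
structure IsTrialFamily (p : Plant n q) (Xt : ℕ → Matrix (Fin n) (Fin q) ℝ) : Prop where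
  zero : Xt 0 = 0
  one : p.C * Xt 1 = -p.F
  indep : LinearIndependent ℝ (fun j : Fin ((n - 1) * q) => vec (Xt (j + 2)))
  span : Submodule.span ℝ (range fun j : Fin ((n - 1) * q) => vec (Xt (j + 2))) =
    LinearMap.ker ((1 : Matrix (Fin q) (Fin q) ℝ) ⊗ₖ p.C).mulVecLin

/-- First phase of the learning algorithm, at its exit: for the current `λ⁺ > 0` the regression
matrix has full column rank, and the symmetric solution `P⁺` of the regression is positive
definite. -/
structure IsLearnedGrowth (d : Experiment n q) (ε lamP : ℝ) (Pp : Matrix (Fin n) (Fin n) ℝ) :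
    Prop where
  full_rank : (d.Psi lamP).rank = (n + 1) * n / 2 + (1 + q) * n
  solves : ∃ (G : Matrix (Fin 1) (Fin n) ℝ) (Z : Matrix (Fin q) (Fin n) ℝ),
    d.Psi lamP *ᵥ Experiment.unknowns Pp G Z = d.Phi ε
  posDef : Pp.PosDef

/-- Policy iteration from data: starting from an admissible gain `K 0`, at each iteration
`k = 0, ..., N` the pair `(P k, K (k + 1))` is obtained, with `P k` symmetric, by solving the
regression of the second phase for the unshifted state. -/
structure IsPolicyIteration (p : Plant n q) (d : Experiment n q) (Q : Matrix (Fin n) (Fin n) ℝ)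
    (lamM : ℝ) (N : ℕ) (P : ℕ → Matrix (Fin n) (Fin n) ℝ) (K : ℕ → Matrix (Fin 1) (Fin n) ℝ) :
    Prop where
  admissible : p.IsAdmissible Q lamM (K 0)
  symm : ∀ k ≤ N, (P k).IsSymm
  solves : ∀ k ≤ N, ∃ Z : Matrix (Fin q) (Fin n) ℝ,
    d.PsiPI lamM 0 (K k) *ᵥ Experiment.unknowns (P k) (K (k + 1)) Z = d.PhiPI Q 0 (K k)

/-- Last phase: with the final value matrix `P`, gain `K` and improved gain `Knew`, estimates
`Bh`, `Dh` of `B`, `D` and estimates `Sh i` of `Xᵢ S - A Xᵢ` are read off the regressions for the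
shifted states `x - Xᵢ v`, and `(X, U)` solves the resulting regulator equations, where `X` is sought
in the form `X₁ + ∑ αᵢ Xᵢ`. -/
def IsLearnedRegulator (d : Experiment n q) (Q : Matrix (Fin n) (Fin n) ℝ) (lamM : ℝ)
    (Xt : ℕ → Matrix (Fin n) (Fin q) ℝ) (P : Matrix (Fin n) (Fin n) ℝ)
    (K Knew : Matrix (Fin 1) (Fin n) ℝ)
    (X : Matrix (Fin n) (Fin q) ℝ) (U : Matrix (Fin 1) (Fin q) ℝ) : Prop :=
  ∃ (Bh : Matrix (Fin n) (Fin 1) ℝ) (Dh : Matrix (Fin n) (Fin q) ℝ)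
    (Sh : ℕ → Matrix (Fin n) (Fin q) ℝ) (α : Fin ((n - 1) * q) → ℝ),
    Knew = Bhᵀ * P ∧ Sh 0 = 0 ∧
    (∀ i ≤ (n - 1) * q + 1,
      d.PsiPI lamM (Xt i) K *ᵥ Experiment.unknowns P Knew ((Dh - Sh i)ᵀ * P)
        = d.PhiPI Q (Xt i) K) ∧
    X = Xt 1 + ∑ j, α j • Xt (j + 2) ∧
    Sh 1 + ∑ j, α j • Sh (j + 2) = Bh * U + Dh

end

end ResilientRegulation

/-! The regulator equations `X S = A X + B U + D` and `C X = -F` make the deviation z = x - X v obey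
z' = (A - B K_k) z in normal operation and z' = A z under attack, while e = C z. Everything thus
reduces to exponential decay of a switched linear system, `DoSAttack.exists_exponential_bound`.

Under attack the energy zᵀ P⁺ z grows at rate at most 2λ⁺ = λ⁻(T - 1). Otherwise zᵀ P_k z decays at
rate at least 2λ⁻ + σ, where σ > 0 is such that Q ≥ σ P_k. After a suitable weighting each change of
status costs at most a factor g, where g² is the product of the condition numbers of P_k and P⁺. On
a window of length Δ the logarithm of the energy ratio is at most a constant plus Δ times log g /
τ_D + (λ⁻(T + 1) + σ) / T - 2λ⁻ - σ. The bound on τ_D says log g / τ_D ≤ λ⁻(T - 1) / T; then all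
terms in λ⁻ cancel and the rate -σ(1 - 1/T) remains. The decay comes from the margin σ alone.

The matrix equations come from the data. Integrating the derivative of yᵀ P y along y = x - X_i v
turns each row of a regression into the vanishing of an integral that is quadratic in y and bilinear
in (y, u) and (y, v); the rank condition forces its coefficients to be zero
(`Experiment.IsRichFor.eq_zero`, `Experiment.IsRichFor.of_regression`). Positive definiteness of P_k
needs no spectral theory: for k = 0 it follows from the finite cost, and P_k is a Lyapunov function
for the loop with gain K_{k+1}, which passes positivity on to P_{k+1}. -/

namespace ResilientRegulation

/-! ### Quadratic forms -/

section QuadraticForms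

variable {n : ℕ}

lemma euclNorm_nonneg (x : Fin n → ℝ) : 0 ≤ euclNorm x := Real.sqrt_nonneg _

lemma euclNorm_sq (x : Fin n → ℝ) : euclNorm x ^ 2 = x ⬝ᵥ x := by
  rw [euclNorm, Real.sq_sqrt (Finset.sum_nonneg fun i _ => sq_nonneg _)]
  simp [dotProduct, sq]

lemma _root_.Matrix.PosDef.quad_pos {P : Matrix (Fin n) (Fin n) ℝ} (hP : P.PosDef)
    {x : Fin n → ℝ} (hx : x ≠ 0) : 0 < x ⬝ᵥ P *ᵥ x := by
  simpa using hP.dotProduct_mulVec_pos hx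

lemma _root_.Matrix.PosDef.quad_nonneg {P : Matrix (Fin n) (Fin n) ℝ} (hP : P.PosDef)
    (x : Fin n → ℝ) : 0 ≤ x ⬝ᵥ P *ᵥ x := by
  simpa using hP.posSemidef.dotProduct_mulVec_nonneg x

lemma _root_.Matrix.PosDef.isSymm {P : Matrix (Fin n) (Fin n) ℝ} (hP : P.PosDef) : P.IsSymm := by
  have h := hP.1
  rwa [Matrix.IsHermitian, conjTranspose_eq_transpose_of_trivial] at h

lemma isHermitian_of_isSymm {P : Matrix (Fin n) (Fin n) ℝ} (hP : P.IsSymm) : P.IsHermitian := by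
  rwa [Matrix.IsHermitian, conjTranspose_eq_transpose_of_trivial]

lemma posDef_of_isSymm {P : Matrix (Fin n) (Fin n) ℝ} (hP : P.IsSymm)
    (h : ∀ x : Fin n → ℝ, x ≠ 0 → 0 < x ⬝ᵥ P *ᵥ x) : P.PosDef :=
  .of_dotProduct_mulVec_pos (isHermitian_of_isSymm hP)
    fun x hx => by simpa using h x hx

lemma quad_comm {P : Matrix (Fin n) (Fin n) ℝ} (hP : P.IsSymm) (x y : Fin n → ℝ) :
    x ⬝ᵥ P *ᵥ y = y ⬝ᵥ P *ᵥ x := by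
  rw [dotProduct_mulVec, ← mulVec_transpose, hP.eq, dotProduct_comm]

lemma continuous_quad (P : Matrix (Fin n) (Fin n) ℝ) :
    Continuous fun x : Fin n → ℝ => x ⬝ᵥ P *ᵥ x := by
  fun_prop

lemma quad_smul (P : Matrix (Fin n) (Fin n) ℝ) (c : ℝ) (x : Fin n → ℝ) :
    (c • x) ⬝ᵥ P *ᵥ (c • x) = c ^ 2 * (x ⬝ᵥ P *ᵥ x) := by
  simp [mulVec_smul, smul_dotProduct, dotProduct_smul]; ring

lemma isCompact_unit_sphere : IsCompact {x : Fin n → ℝ | x ⬝ᵥ x = 1} := by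
  refine Metric.isCompact_of_isClosed_isBounded
    (isClosed_eq (by fun_prop) continuous_const) ?_
  -- The ambient norm is the sup norm, so boundedness of the Euclidean sphere is checked
  -- coordinatewise.
  refine (Metric.isBounded_iff_subset_closedBall 0).2 ⟨1, fun x hx => ?_⟩
  rw [mem_closedBall_zero_iff, pi_norm_le_iff_of_nonneg zero_le_one]
  intro i
  have h : x i * x i ≤ x ⬝ᵥ x :=
    Finset.single_le_sum (f := fun i => x i * x i) (fun j _ => mul_self_nonneg _)
      (Finset.mem_univ i)
  rw [mem_ofPred_eq] at hx
  rw [Real.norm_eq_abs, abs_le_one_iff_mul_self_le_one]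
  linarith

/-- The ratio of two quadratic forms, the second one positive definite, attains its minimum. -/
lemma exists_minimizing_ratio (P : Matrix (Fin n) (Fin n) ℝ) {R : Matrix (Fin n) (Fin n) ℝ}
    (hR : R.PosDef) (hn : ∃ x : Fin n → ℝ, x ≠ 0) :
    ∃ (r : ℝ) (z : Fin n → ℝ), z ≠ 0 ∧ z ⬝ᵥ P *ᵥ z = r * (z ⬝ᵥ R *ᵥ z) ∧
      ∀ x, r * (x ⬝ᵥ R *ᵥ x) ≤ x ⬝ᵥ P *ᵥ x := by
  have key : ∀ x : Fin n → ℝ, x ≠ 0 → ∃ c : ℝ, 0 < c ∧ (c • x) ⬝ᵥ (c • x) = 1 := by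
    intro x hx
    have h : 0 < x ⬝ᵥ x := by
      simpa using (PosDef.one (n := Fin n) (R := ℝ)).quad_pos hx
    refine ⟨(Real.sqrt (x ⬝ᵥ x))⁻¹, by positivity, ?_⟩
    simp only [smul_dotProduct, dotProduct_smul, smul_eq_mul]
    rw [← mul_assoc, ← mul_inv, Real.mul_self_sqrt h.le, inv_mul_cancel₀ h.ne']
  have hne : ∀ x : Fin n → ℝ, x ⬝ᵥ x = 1 → x ≠ 0 := by
    rintro x hx rfl
    simp at hx
  obtain ⟨x₀, hx₀⟩ := hn
  obtain ⟨c₀, -, hc₀⟩ := key x₀ hx₀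
  -- The ratio is homogeneous of degree 0, so its minimum over the compact sphere is global.
  obtain ⟨z, hz, hmin⟩ := isCompact_unit_sphere.exists_isMinOn ⟨c₀ • x₀, hc₀⟩
    (f := fun x => (x ⬝ᵥ P *ᵥ x) / (x ⬝ᵥ R *ᵥ x))
    ((continuous_quad P).continuousOn.div (continuous_quad R).continuousOn
      fun x hx => (hR.quad_pos (hne x hx)).ne')
  refine ⟨_, z, hne z hz, (div_mul_cancel₀ _ (hR.quad_pos (hne z hz)).ne').symm, fun x => ?_⟩
  rcases eq_or_ne x 0 with rfl | hx
  · simp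
  obtain ⟨c, hc, hc1⟩ := key x hx
  have h := hmin hc1
  simp only [mem_ofPred_eq, quad_smul] at h
  rw [mul_div_mul_left _ _ (by positivity)] at h
  exact (le_div_iff₀ (hR.quad_pos hx)).1 h

/-- A positive definite form dominates any other one. -/
lemma exists_quad_le (P : Matrix (Fin n) (Fin n) ℝ) {R : Matrix (Fin n) (Fin n) ℝ}
    (hR : R.PosDef) : ∃ c > 0, ∀ x, x ⬝ᵥ P *ᵥ x ≤ c * (x ⬝ᵥ R *ᵥ x) := by
  by_cases hn : ∃ x : Fin n → ℝ, x ≠ 0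
  -- The minimal ratio of `-P` to `R` is minus the best constant; the maximum with 1 only secures
  -- positivity.
  · obtain ⟨r, -, -, -, h⟩ := exists_minimizing_ratio (-P) hR hn
    refine ⟨max 1 (-r), lt_max_of_lt_left one_pos, fun x => ?_⟩
    have h1 := h x
    rw [neg_mulVec, dotProduct_neg] at h1
    have h2 : -r * (x ⬝ᵥ R *ᵥ x) ≤ max 1 (-r) * (x ⬝ᵥ R *ᵥ x) :=
      mul_le_mul_of_nonneg_right (le_max_right _ _) (hR.quad_nonneg x)
    linarith
  · push Not at hn
    exact ⟨1, one_pos, fun x => by simp [hn x]⟩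

open scoped MatrixOrder in
lemma quad_le_lambdaMax {P : Matrix (Fin n) (Fin n) ℝ} (hP : P.PosDef) (x : Fin n → ℝ) :
    x ⬝ᵥ P *ᵥ x ≤ lambdaMax P * (x ⬝ᵥ x) := by
  have h : (lambdaMax P • 1 - P).PosSemidef := by
    rw [← Matrix.le_iff, ← Algebra.algebraMap_eq_smul_one]
    exact (le_algebraMap_iff_spectrum_le hP.1).2
      fun r hr => le_csSup P.finite_real_spectrum.bddAbove hr
  have := h.dotProduct_mulVec_nonneg x
  simp [sub_mulVec, smul_mulVec, dotProduct_sub, dotProduct_smul] at this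
  linarith

open scoped MatrixOrder in
lemma lambdaMin_le_quad {P : Matrix (Fin n) (Fin n) ℝ} (hP : P.PosDef) (x : Fin n → ℝ) :
    lambdaMin P * (x ⬝ᵥ x) ≤ x ⬝ᵥ P *ᵥ x := by
  have h : (P - lambdaMin P • 1).PosSemidef := by
    rw [← Matrix.le_iff, ← Algebra.algebraMap_eq_smul_one]
    exact (algebraMap_le_iff_le_spectrum hP.1).2
      fun r hr => csInf_le P.finite_real_spectrum.bddBelow hr
  have := h.dotProduct_mulVec_nonneg x
  simp [sub_mulVec, smul_mulVec, dotProduct_sub, dotProduct_smul] at this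
  linarith

/-- In dimension 0 the spectrum is empty and `sInf ∅ = 0`, hence `NeZero n`. -/
lemma lambdaMin_pos [NeZero n] {P : Matrix (Fin n) (Fin n) ℝ} (hP : P.PosDef) :
    0 < lambdaMin P := by
  have hne : (spectrum ℝ P).Nonempty := by
    rw [hP.1.spectrum_real_eq_range_eigenvalues]
    exact range_nonempty _
  have hmem : lambdaMin P ∈ spectrum ℝ P := hne.csInf_mem P.finite_real_spectrum
  rw [hP.1.spectrum_real_eq_range_eigenvalues] at hmem
  obtain ⟨i, hi⟩ := hmem
  exact hi ▸ hP.eigenvalues_pos i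

lemma lambdaMin_le_lambdaMax [NeZero n] {P : Matrix (Fin n) (Fin n) ℝ} (hP : P.PosDef) :
    lambdaMin P ≤ lambdaMax P := by
  have h := (lambdaMin_le_quad hP (Pi.single 0 1)).trans (quad_le_lambdaMax hP _)
  simpa using h

end QuadraticForms

/-! ### Lyapunov equations -/

section Lyapunov

variable {n : ℕ}

/-- Both sides are the derivative of xᵀ P x along x' = M x. -/
lemma quad_lyapunov {P : Matrix (Fin n) (Fin n) ℝ} (hP : P.IsSymm)
    (M : Matrix (Fin n) (Fin n) ℝ) (x : Fin n → ℝ) :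
    x ⬝ᵥ (Mᵀ * P + P * M) *ᵥ x = 2 * ((M *ᵥ x) ⬝ᵥ P *ᵥ x) := by
  rw [add_mulVec, dotProduct_add, ← mulVec_mulVec, ← mulVec_mulVec, dotProduct_mulVec x Mᵀ,
    vecMul_transpose, quad_comm hP x (M *ᵥ x)]
  ring

/-- If one Lyapunov equation of `M` has a positive definite solution, then so have all. -/
lemma posDef_of_lyapunov_of_lyapunov {M P R P₀ R₀ : Matrix (Fin n) (Fin n) ℝ} (hP : P.IsSymm)
    (hR : R.PosDef) (hPR : Mᵀ * P + P * M = -R) (hP₀ : P₀.PosDef) (hR₀ : R₀.PosDef)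
    (hPR₀ : Mᵀ * P₀ + P₀ * M = -R₀) : P.PosDef := by
  by_contra hcon
  have : ∃ x : Fin n → ℝ, x ≠ 0 ∧ x ⬝ᵥ P *ᵥ x ≤ 0 := by
    by_contra! h
    exact hcon (posDef_of_isSymm hP h)
  obtain ⟨x, hx, hxP⟩ := this
  -- Subtract the largest multiple of `P₀` that keeps the difference positive semidefinite: `P - r •
  -- P₀` then has a kernel vector z, and r ≤ 0 because `P` is not positive definite.
  obtain ⟨r, z, hz, hzr, hr⟩ := exists_minimizing_ratio P hP₀ ⟨x, hx⟩
  have hr0 : r ≤ 0 := by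
    by_contra! h
    have := mul_pos h (hP₀.quad_pos hx)
    linarith [hr x]
  have hNs : (P - r • P₀).IsSymm := hP.sub (hP₀.isSymm.smul r)
  have hN : (P - r • P₀).PosSemidef := by
    refine .of_dotProduct_mulVec_nonneg (isHermitian_of_isSymm hNs) fun y => ?_
    simp only [star_trivial, sub_mulVec, smul_mulVec, dotProduct_sub, dotProduct_smul, smul_eq_mul]
    linarith [hr y]
  have hNz : (P - r • P₀) *ᵥ z = 0 := by
    rw [← hN.dotProduct_mulVec_zero_iff]
    simp only [star_trivial, sub_mulVec, smul_mulVec, dotProduct_sub, dotProduct_smul, smul_eq_mul]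
    linarith
  -- The Lyapunov form of `P - r • P₀` vanishes at its kernel vector z, yet it equals -zᵀ R z + r zᵀ
  -- R₀ z < 0.
  have h0 := quad_lyapunov hNs M z
  rw [hNz, dotProduct_zero, mul_zero,
    show Mᵀ * (P - r • P₀) + (P - r • P₀) * M = -R + r • R₀ by
      rw [← hPR, ← neg_neg R₀, ← hPR₀]
      simp only [Matrix.mul_sub, Matrix.sub_mul, Matrix.mul_smul, Matrix.smul_mul, smul_neg,
        smul_add]
      abel] at h0
  simp only [add_mulVec, neg_mulVec, smul_mulVec, dotProduct_add, dotProduct_neg, dotProduct_smul,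
    smul_eq_mul] at h0
  have h1 := hR.quad_pos hz
  have h2 := mul_nonneg_of_nonpos_of_nonpos hr0 (neg_nonpos.2 (hR₀.quad_nonneg z))
  linarith

lemma hasDerivAt_quad {P : Matrix (Fin n) (Fin n) ℝ} (hP : P.IsSymm) {ζ : ℝ → Fin n → ℝ}
    {ζ' : Fin n → ℝ} {t : ℝ} (h : HasDerivAt ζ ζ' t) :
    HasDerivAt (fun s => ζ s ⬝ᵥ P *ᵥ ζ s) (2 * (ζ' ⬝ᵥ P *ᵥ ζ t)) t := by
  have hi : ∀ i, HasDerivAt (fun s => ζ s i) (ζ' i) t := hasDerivAt_pi.1 h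
  have h2 : HasDerivAt (fun s => ∑ i, ζ s i * ∑ j, P i j * ζ s j)
      (∑ i, (ζ' i * ∑ j, P i j * ζ t j + ζ t i * ∑ j, P i j * ζ' j)) t :=
    HasDerivAt.fun_sum fun i _ => (hi i).mul (HasDerivAt.fun_sum fun j _ => (hi j).const_mul _)
  refine h2.congr_deriv ?_
  rw [Finset.sum_add_distrib]
  change ζ' ⬝ᵥ P *ᵥ ζ t + ζ t ⬝ᵥ P *ᵥ ζ' = _
  rw [quad_comm hP (ζ t) ζ', two_mul]

/-- Every initial value problem `ζ' = M ζ`, `ζ 0 = x ≠ 0`, has a solution, without zeros. -/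
lemma exists_linear_flow (M : Matrix (Fin n) (Fin n) ℝ) {x : Fin n → ℝ} (hx : x ≠ 0) :
    ∃ ζ : ℝ → Fin n → ℝ, ζ 0 = x ∧ (∀ t, HasDerivAt ζ (M *ᵥ ζ t) t) ∧ ∀ t, ζ t ≠ 0 := by
  let L : (Fin n → ℝ) →L[ℝ] (Fin n → ℝ) := M.mulVecLin.toContinuousLinearMap
  refine ⟨fun t => NormedSpace.exp (t • L) x, by simp, fun t => ?_, fun t h => hx ?_⟩
  · simpa [L] using (hasDerivAt_exp_smul_const' (𝕂 := ℝ) L t).clm_apply (hasDerivAt_const t x)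
  · have h1 : NormedSpace.exp (-(t • L)) * NormedSpace.exp (t • L) = 1 := by
      let +nondep : NormedAlgebra ℚ ((Fin n → ℝ) →L[ℝ] (Fin n → ℝ)) := .restrictScalars ℚ ℝ _
      have h2 := NormedSpace.exp_add_of_commute (Commute.refl (t • L)).neg_left
      rwa [neg_add_cancel, NormedSpace.exp_zero, eq_comm] at h2
    have h2 := congrArg (fun f : (Fin n → ℝ) →L[ℝ] (Fin n → ℝ) => f x) h1
    simpa [h] using h2.symm

/-- The symmetric solution of a Lyapunov equation of `M` is positive definite as soon as all
trajectories of `M` are square integrable. -/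
lemma posDef_of_lyapunov_of_integrable {M P R Q : Matrix (Fin n) (Fin n) ℝ} (hP : P.IsSymm)
    (hR : R.PosDef) (hPR : Mᵀ * P + P * M = -R) (hQ : Q.PosDef)
    (hint : ∀ ζ : ℝ → Fin n → ℝ, (∀ t, HasDerivAt ζ (M *ᵥ ζ t) t) →
      IntegrableOn (fun t => ζ t ⬝ᵥ Q *ᵥ ζ t) (Ioi 0)) : P.PosDef := by
  refine posDef_of_isSymm hP fun x hx => ?_
  by_contra! hxP
  obtain ⟨ζ, h0, hζ, hne⟩ := exists_linear_flow M hx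
  have hd : ∀ t, HasDerivAt (fun s => ζ s ⬝ᵥ P *ᵥ ζ s) (-(ζ t ⬝ᵥ R *ᵥ ζ t)) t := fun t => by
    refine (hasDerivAt_quad hP (hζ t)).congr_deriv ?_
    rw [← quad_lyapunov hP, hPR, neg_mulVec, dotProduct_neg]
  have hanti : StrictAnti fun s => ζ s ⬝ᵥ P *ᵥ ζ s :=
    strictAnti_of_hasDerivAt_neg hd fun t => neg_lt_zero.2 (hR.quad_pos (hne t))
  -- The energy may be 0 at time 0; strict decrease makes it negative at time 1 and keeps it below
  -- that value afterwards.
  have h1 : ζ 1 ⬝ᵥ P *ᵥ ζ 1 < 0 := by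
    have := hanti zero_lt_one
    simp only [h0] at this
    linarith
  obtain ⟨c, hc, hcQ⟩ := exists_quad_le (-P) hQ
  -- Since -P ≤ c Q, the integrable function ζᵀ Q ζ dominates a positive constant on a half-line,
  -- which is absurd.
  have hfin : IntegrableOn (fun _ : ℝ => -(ζ 1 ⬝ᵥ P *ᵥ ζ 1) / c) (Ioi 1) := by
    refine ((hint ζ hζ).mono_set (Ioi_subset_Ioi zero_le_one)).mono'
      aestronglyMeasurable_const ?_
    refine (ae_restrict_iff' measurableSet_Ioi).2 (.of_forall fun t ht => ?_)
    have hpos : 0 < -(ζ 1 ⬝ᵥ P *ᵥ ζ 1) / c := div_pos (by linarith) hc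
    rw [Real.norm_of_nonneg hpos.le, div_le_iff₀ hc]
    have h2 := hcQ (ζ t)
    have h3 : ζ t ⬝ᵥ P *ᵥ ζ t < ζ 1 ⬝ᵥ P *ᵥ ζ 1 := hanti ht
    rw [neg_mulVec, dotProduct_neg] at h2
    linarith
  rw [integrableOn_const_iff] at hfin
  rcases hfin with h | h
  · exact (div_pos (by linarith) hc : 0 < -(ζ 1 ⬝ᵥ P *ᵥ ζ 1) / c).ne' (by simpa using h)
  · simp at h

end Lyapunov

/-! ### Trajectories -/

section Trajectories

/-- Integration by parts for indefinite integrals. -/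
lemma mul_sub_mul_eq_integral {f g f' g' : ℝ → ℝ} {a b : ℝ} (hab : a ≤ b)
    (hf' : IntervalIntegrable f' volume a b) (hg' : IntervalIntegrable g' volume a b)
    (hf : ∀ t ∈ Icc a b, f t = f a + ∫ s in a..t, f' s)
    (hg : ∀ t ∈ Icc a b, g t = g a + ∫ s in a..t, g' s) :
    f b * g b - f a * g a = ∫ s in a..b, (f' s * g s + f s * g' s) := by
  -- Nothing is known of f and g outside [a, b], so they are replaced by the primitives, which are
  -- absolutely continuous and agree with them on [a, b].
  have ac : ∀ {h h' : ℝ → ℝ}, IntervalIntegrable h' volume a b →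
      AbsolutelyContinuousOnInterval (fun t => h a + ∫ s in a..t, h' s) a b := fun {h h'} hh => by
    have h1 := hh.absolutelyContinuousOnInterval_intervalIntegral (c := a) left_mem_uIcc
    have h2 : AbsolutelyContinuousOnInterval (fun _ : ℝ => h a) a b :=
      ((LipschitzWith.const (h a)).lipschitzOnWith
        (s := uIcc a b)).absolutelyContinuousOnInterval
    exact h2.add h1
  have key := (ac (h := f) hf').integral_deriv_mul_eq_sub (ac (h := g) hg')
  rw [hf b (right_mem_Icc.2 hab), hg b (right_mem_Icc.2 hab)]
  simp only [intervalIntegral.integral_same, add_zero] at key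
  rw [← key]
  refine intervalIntegral.integral_congr_ae ?_
  filter_upwards [hf'.ae_hasDerivAt_integral, hg'.ae_hasDerivAt_integral] with t h1 h2 ht
  have ht' := uIoc_subset_uIcc ht
  rw [((h1 ht' a left_mem_uIcc).const_add (f a)).deriv,
    ((h2 ht' a left_mem_uIcc).const_add (g a)).deriv]
  rw [uIcc_of_le hab] at ht'
  rw [hf t ht', hg t ht']

variable {n q : ℕ}

lemma intervalIntegral_apply {f : ℝ → Fin n → ℝ} {a b : ℝ}
    (hf : IntervalIntegrable f volume a b) (i : Fin n) :
    (∫ s in a..b, f s) i = ∫ s in a..b, f s i :=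
  ((ContinuousLinearMap.proj (R := ℝ) (φ := fun _ : Fin n => ℝ) i).intervalIntegral_comp_comm
    hf).symm

lemma _root_.IntervalIntegrable.apply {f : ℝ → Fin n → ℝ} {a b : ℝ}
    (hf : IntervalIntegrable f volume a b) (i : Fin n) :
    IntervalIntegrable (fun s => f s i) volume a b :=
  ⟨(integrable_pi_iff.1 hf.1) i, (integrable_pi_iff.1 hf.2) i⟩

lemma _root_.IntervalIntegrable.mulVec {m : ℕ} {f : ℝ → Fin n → ℝ} {a b : ℝ}
    (hf : IntervalIntegrable f volume a b) (M : Matrix (Fin m) (Fin n) ℝ) :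
    IntervalIntegrable (fun s => M *ᵥ f s) volume a b :=
  ⟨M.mulVecLin.toContinuousLinearMap.integrable_comp hf.1,
    M.mulVecLin.toContinuousLinearMap.integrable_comp hf.2⟩

lemma mulVec_intervalIntegral {m : ℕ} {f : ℝ → Fin n → ℝ} {a b : ℝ}
    (hf : IntervalIntegrable f volume a b) (M : Matrix (Fin m) (Fin n) ℝ) :
    M *ᵥ (∫ s in a..b, f s) = ∫ s in a..b, M *ᵥ f s :=
  (M.mulVecLin.toContinuousLinearMap.intervalIntegral_comp_comm hf).symm

/-- Increment of a quadratic form along an indefinite integral. -/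
lemma quad_sub_quad_eq_integral {P : Matrix (Fin n) (Fin n) ℝ} (hP : P.IsSymm)
    {y w : ℝ → Fin n → ℝ} {a b : ℝ} (hab : a ≤ b) (hyc : ContinuousOn y (Icc a b))
    (hw : IntervalIntegrable w volume a b)
    (hy : ∀ t ∈ Icc a b, y t = y a + ∫ s in a..t, w s) :
    y b ⬝ᵥ P *ᵥ y b - y a ⬝ᵥ P *ᵥ y a = ∫ s in a..b, 2 * (w s ⬝ᵥ P *ᵥ y s) := by
  have hsub : ∀ t ∈ Icc a b, IntervalIntegrable w volume a t := fun t ht =>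
    hw.mono_set (by rw [uIcc_of_le hab, uIcc_of_le ht.1]; exact Icc_subset_Icc_right ht.2)
  have hc : ∀ i, ContinuousOn (fun s => y s i) (uIcc a b) := fun i => by
    rw [uIcc_of_le hab]
    exact continuousOn_pi.1 hyc i
  have hPc : ∀ i, ContinuousOn (fun s => (P *ᵥ y s) i) (uIcc a b) := fun i => by
    rw [← uIcc_of_le hab] at hyc
    fun_prop
  have hi : ∀ i, y b i * (P *ᵥ y b) i - y a i * (P *ᵥ y a) i
      = ∫ s in a..b, (w s i * (P *ᵥ y s) i + y s i * (P *ᵥ w s) i) := fun i => by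
    refine mul_sub_mul_eq_integral (f := fun s => y s i) (g := fun s => (P *ᵥ y s) i) hab
      (hw.apply i) ((hw.mulVec P).apply i) (fun t ht => ?_)
      fun t ht => ?_
    · conv_lhs => rw [hy t ht]
      rw [Pi.add_apply, intervalIntegral_apply (hsub t ht)]
    · conv_lhs => rw [hy t ht]
      rw [mulVec_add, Pi.add_apply, mulVec_intervalIntegral (hsub t ht),
        intervalIntegral_apply ((hsub t ht).mulVec P)]
  simp only [dotProduct]
  rw [← Finset.sum_sub_distrib, Finset.sum_congr rfl fun i _ => hi i,
    ← intervalIntegral.integral_finsetSum fun i _ =>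
      ((hw.apply i).mul_continuousOn (hPc i)).add
        (((hw.mulVec P).apply i).continuousOn_mul (hc i))]
  refine intervalIntegral.integral_congr fun s _ => ?_
  rw [Finset.sum_add_distrib]
  change w s ⬝ᵥ P *ᵥ y s + y s ⬝ᵥ P *ᵥ w s = 2 * (w s ⬝ᵥ P *ᵥ y s)
  rw [quad_comm hP (y s), two_mul]

namespace Plant

variable (p : Plant n q)

/-- The plant seen by the shifted state `x - Y v`. -/
def shift (Y : Matrix (Fin n) (Fin q) ℝ) : Plant n q :=
  { p with D := p.D + p.A * Y - Y * p.S }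

variable {p}

lemma IsExoTrajectory.continuousOn {v : ℝ → Fin q → ℝ} (hv : p.IsExoTrajectory v) {a b : ℝ}
    (ha : 0 ≤ a) : ContinuousOn v (Icc a b) := fun t ht =>
  (hv t (ha.trans ht.1)).continuousWithinAt.mono fun _ hs => ha.trans hs.1

lemma IsExoTrajectory.eq_add_integral {v : ℝ → Fin q → ℝ} (hv : p.IsExoTrajectory v) {a t : ℝ}
    (ha : 0 ≤ a) (hat : a ≤ t) : v t = v a + ∫ s in a..t, p.S *ᵥ v s := by
  have hc := hv.continuousOn (b := t) ha
  rw [intervalIntegral.integral_eq_sub_of_hasDerivAt_of_le hat hc (fun s hs =>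
    (hv s (ha.trans hs.1.le)).hasDerivAt (Ici_mem_nhds (ha.trans_lt hs.1)))]
  · abel
  · refine ContinuousOn.intervalIntegrable ?_
    rw [uIcc_of_le hat]
    fun_prop

lemma IsTrajectoryOn.intervalIntegrable {x : ℝ → Fin n → ℝ} {u : ℝ → Fin 1 → ℝ}
    {v : ℝ → Fin q → ℝ} {a b : ℝ} (h : p.IsTrajectoryOn x u v a b) (hab : a ≤ b)
    (hv : ContinuousOn v (Icc a b)) :
    IntervalIntegrable (fun s => p.A *ᵥ x s + p.B *ᵥ u s + p.D *ᵥ v s) volume a b := by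
  rw [← uIcc_of_le hab] at hv
  have hx := h.1
  rw [← uIcc_of_le hab] at hx
  exact ((hx.intervalIntegrable.mulVec _).add (h.2.1.mulVec _)).add (hv.intervalIntegrable.mulVec _)

/-- Substituting x = y + Y v and v' = S v changes only the coefficient of v, so all shifted
regressions share the same A and B. The output matrices play no role here and are kept as they are.
-/
lemma IsTrajectoryOn.shift {x : ℝ → Fin n → ℝ} {u : ℝ → Fin 1 → ℝ} {v : ℝ → Fin q → ℝ}
    {a b : ℝ} (h : p.IsTrajectoryOn x u v a b) (ha : 0 ≤ a) (hab : a ≤ b)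
    (hv : p.IsExoTrajectory v) (Y : Matrix (Fin n) (Fin q) ℝ) :
    (p.shift Y).IsTrajectoryOn (fun t => x t - Y *ᵥ v t) u v a b := by
  have hvc := hv.continuousOn (b := b) ha
  have hi := h.intervalIntegrable hab hvc
  refine ⟨h.1.sub (by fun_prop), h.2.1, fun t ht => ?_⟩
  have hsub : uIcc a t ⊆ uIcc a b := by
    rw [uIcc_of_le hab, uIcc_of_le ht.1]
    exact Icc_subset_Icc_right ht.2
  have hvi : IntervalIntegrable (fun s => p.S *ᵥ v s) volume a t := by
    rw [← uIcc_of_le hab] at hvc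
    exact (hvc.mono hsub).intervalIntegrable.mulVec _
  dsimp only
  conv_lhs => rw [h.2.2 t ht, hv.eq_add_integral ha ht.1]
  rw [mulVec_add, mulVec_intervalIntegral hvi, add_sub_add_comm,
    ← intervalIntegral.integral_sub (hi.mono_set hsub) (hvi.mulVec Y)]
  congr 1
  refine intervalIntegral.integral_congr fun s _ => ?_
  simp only [Plant.shift, mulVec_sub, sub_mulVec, add_mulVec, ← mulVec_mulVec]
  abel

/-- Increment of a quadratic form along a trajectory of the plant. -/
lemma IsTrajectoryOn.quad_sub_quad {x : ℝ → Fin n → ℝ} {u : ℝ → Fin 1 → ℝ} {v : ℝ → Fin q → ℝ}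
    {a b : ℝ} (h : p.IsTrajectoryOn x u v a b) (hab : a ≤ b) (hv : ContinuousOn v (Icc a b))
    {P : Matrix (Fin n) (Fin n) ℝ} (hP : P.IsSymm) :
    x b ⬝ᵥ P *ᵥ x b - x a ⬝ᵥ P *ᵥ x a =
      ∫ s in a..b, (x s ⬝ᵥ (p.Aᵀ * P + P * p.A) *ᵥ x s
        + 2 * (u s ⬝ᵥ (p.Bᵀ * P) *ᵥ x s) + 2 * (v s ⬝ᵥ (p.Dᵀ * P) *ᵥ x s)) := by
  rw [quad_sub_quad_eq_integral hP hab h.1 (h.intervalIntegrable hab hv) h.2.2]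
  refine intervalIntegral.integral_congr fun s _ => ?_
  rw [quad_lyapunov hP, ← mulVec_mulVec, ← mulVec_mulVec, dotProduct_mulVec (u s),
    dotProduct_mulVec (v s), vecMul_transpose, vecMul_transpose]
  simp only [add_dotProduct]
  ring

end Plant

end Trajectories

/-! ### Regression on recorded data -/

section Regression

variable {n q : ℕ}

/-- Coefficients of the quadratic form of `M` with respect to the products `x i * x j`, `i ≤ j`. -/
def quadCoeff (M : Matrix (Fin n) (Fin n) ℝ) : UpperIndex n → ℝ :=
  fun ij => if ij.1.1 = ij.1.2 then M ij.1.1 ij.1.2 else M ij.1.1 ij.1.2 + M ij.1.2 ij.1.1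

lemma quadCoeff_eq_vecs {M : Matrix (Fin n) (Fin n) ℝ} (hM : M.IsSymm) :
    quadCoeff M = vecs M := by
  funext ij
  simp only [quadCoeff, vecs, hM.apply ij.1.1 ij.1.2, two_mul]

lemma eq_zero_of_vecs_eq_zero {M : Matrix (Fin n) (Fin n) ℝ} (hM : M.IsSymm) (h : vecs M = 0) :
    M = 0 := by
  have key : ∀ i j, i ≤ j → M i j = 0 := fun i j hij => by
    have := congrFun h ⟨(i, j), hij⟩
    simp only [vecs, Pi.zero_apply] at this
    split_ifs at this
    · exact this
    · linarith
  ext i j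
  rcases le_total i j with hij | hij
  · exact key i j hij
  · rw [← hM.apply]
    exact key j i hij

lemma sum_upperIndex (F : Fin n × Fin n → ℝ) :
    ∑ ij : UpperIndex n, (if ij.1.1 = ij.1.2 then F ij.1 else F ij.1 + F ij.1.swap) =
      ∑ ij, F ij := by
  have h1 : ∑ ij : UpperIndex n, (if ij.1.1 = ij.1.2 then F ij.1 else F ij.1 + F ij.1.swap) =
      ∑ ij : Fin n × Fin n, if ij.1 ≤ ij.2 then
        (if ij.1 = ij.2 then F ij else F ij + F ij.swap) else 0 := by
    rw [← Finset.sum_filter]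
    exact (Finset.sum_subtype _ (by simp)
      fun ij : Fin n × Fin n => if ij.1 = ij.2 then F ij else F ij + F ij.swap).symm
  have h2 : ∑ ij : Fin n × Fin n, (if ij.1 < ij.2 then F ij.swap else 0) =
      ∑ ij : Fin n × Fin n, (if ij.2 < ij.1 then F ij else 0) :=
    Fintype.sum_equiv (Equiv.prodComm _ _) _ _ fun ij => rfl
  have h3 : ∀ ij : Fin n × Fin n, (if ij.1 ≤ ij.2 then
      (if ij.1 = ij.2 then F ij else F ij + F ij.swap) else 0) =
      (if ij.1 ≤ ij.2 then F ij else 0) + (if ij.1 < ij.2 then F ij.swap else 0) := fun ij => by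
    rcases lt_trichotomy ij.1 ij.2 with h | h | h
    · simp [h, h.le, h.ne]
    · simp [h]
    · simp [not_le.2 h, not_lt.2 h.le]
  rw [h1, Finset.sum_congr rfl fun ij _ => h3 ij, Finset.sum_add_distrib, h2,
    ← Finset.sum_add_distrib]
  refine Finset.sum_congr rfl fun ij _ => ?_
  rcases le_or_gt ij.1 ij.2 with h | h
  · simp [h, not_lt.2 h]
  · simp [h, not_le.2 h]

lemma vecv_dotProduct_quadCoeff (M : Matrix (Fin n) (Fin n) ℝ) (x : Fin n → ℝ) :
    vecv x ⬝ᵥ quadCoeff M = x ⬝ᵥ M *ᵥ x := by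
  have h := sum_upperIndex fun ij : Fin n × Fin n => x ij.1 * (M ij.1 ij.2 * x ij.2)
  rw [Fintype.sum_prod_type] at h
  simp only [dotProduct, mulVec, Finset.mul_sum]
  rw [← h]
  refine Finset.sum_congr rfl fun ij _ => ?_
  simp only [vecv, quadCoeff, Prod.fst_swap, Prod.snd_swap]
  split_ifs <;> ring

lemma quad_eq_sum (M : Matrix (Fin n) (Fin n) ℝ) (x : Fin n → ℝ) :
    x ⬝ᵥ M *ᵥ x = ∑ ij : UpperIndex n, x ij.1.1 * x ij.1.2 * quadCoeff M ij :=
  (vecv_dotProduct_quadCoeff M x).symm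

lemma card_upperIndex : Fintype.card (UpperIndex n) = (n + 1) * n / 2 := by
  rw [← Fintype.card_congr (Sym2.sortEquiv (α := Fin n)), Sym2.card, Fintype.card_fin,
    Nat.choose_two_right, Nat.add_sub_cancel]

/-- `vec` stacks columns, so its index is (column, row); this is why the first signal of `Gam a b`
appears on the right of the bilinear form. -/
lemma bilin_eq_sum {k m : ℕ} (M : Matrix (Fin m) (Fin k) ℝ) (x : Fin k → ℝ) (y : Fin m → ℝ) :
    y ⬝ᵥ M *ᵥ x = ∑ il : Fin k × Fin m, x il.1 * y il.2 * vec M il := by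
  simp only [dotProduct, mulVec, Finset.mul_sum, Fintype.sum_prod_type]
  rw [Finset.sum_comm]
  refine Finset.sum_congr rfl fun i _ => Finset.sum_congr rfl fun j _ => ?_
  simp only [vec]
  ring

namespace Experiment

variable (d : Experiment n q)

/-- All products of entries of the signals `a` and `b` are integrable on the recording intervals. -/
def ProductsIntegrable {k m : ℕ} (a : ℝ → Fin k → ℝ) (b : ℝ → Fin m → ℝ) : Prop :=
  ∀ j : Fin (d.s + 1), ∀ i l,
    IntervalIntegrable (fun τ => a τ i * b τ l) volume (d.t (2 * j)) (d.t (2 * j + 1))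

variable {d}

lemma ProductsIntegrable.bilin {k m : ℕ} {a : ℝ → Fin k → ℝ} {b : ℝ → Fin m → ℝ}
    (h : d.ProductsIntegrable a b) (M : Matrix (Fin m) (Fin k) ℝ) (j : Fin (d.s + 1)) :
    IntervalIntegrable (fun τ => b τ ⬝ᵥ M *ᵥ a τ) volume (d.t (2 * j)) (d.t (2 * j + 1)) := by
  simp only [bilin_eq_sum]
  exact ⟨integrable_finsetSum _ fun il _ => ((h j il.1 il.2).mul_const _).1,
    integrable_finsetSum _ fun il _ => ((h j il.1 il.2).mul_const _).2⟩

lemma Gam_mulVec_vec {k m : ℕ} {a : ℝ → Fin k → ℝ} {b : ℝ → Fin m → ℝ}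
    (h : d.ProductsIntegrable a b) (M : Matrix (Fin m) (Fin k) ℝ) (j : Fin (d.s + 1)) :
    (d.Gam a b *ᵥ vec M) j = ∫ τ in (d.t (2 * j))..(d.t (2 * j + 1)), b τ ⬝ᵥ M *ᵥ a τ := by
  simp only [bilin_eq_sum]
  rw [intervalIntegral.integral_finsetSum fun il _ => (h j il.1 il.2).mul_const _]
  simp only [intervalIntegral.integral_mul_const]
  rfl

lemma Lam_mulVec_quadCoeff {a : ℝ → Fin n → ℝ} (h : d.ProductsIntegrable a a)
    (M : Matrix (Fin n) (Fin n) ℝ) (j : Fin (d.s + 1)) :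
    (d.Lam a *ᵥ quadCoeff M) j =
      ∫ τ in (d.t (2 * j))..(d.t (2 * j + 1)), a τ ⬝ᵥ M *ᵥ a τ := by
  simp only [quad_eq_sum]
  rw [intervalIntegral.integral_finsetSum fun il _ =>
    ((h j il.1.1 il.1.2).mul_const (quadCoeff M il))]
  simp only [intervalIntegral.integral_mul_const]
  rfl

lemma delta_mulVec_vecs {P : Matrix (Fin n) (Fin n) ℝ} (hP : P.IsSymm) (a : ℝ → Fin n → ℝ)
    (j : Fin (d.s + 1)) :
    (d.delta a *ᵥ vecs P) j = a (d.t (2 * j + 1)) ⬝ᵥ P *ᵥ a (d.t (2 * j + 1))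
      - a (d.t (2 * j)) ⬝ᵥ P *ᵥ a (d.t (2 * j)) := by
  rw [← vecv_dotProduct_quadCoeff, ← vecv_dotProduct_quadCoeff, ← sub_dotProduct,
    quadCoeff_eq_vecs hP]
  rfl

/-- Rich data separate quadratic-bilinear integrands. -/
lemma IsRichFor.eq_zero {Y : Matrix (Fin n) (Fin q) ℝ} (hr : d.IsRichFor Y)
    (hyy : d.ProductsIntegrable (d.shifted Y) (d.shifted Y))
    (hyu : d.ProductsIntegrable (d.shifted Y) d.u)
    (hyv : d.ProductsIntegrable (d.shifted Y) d.v)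
    {M : Matrix (Fin n) (Fin n) ℝ} (hM : M.IsSymm) {N : Matrix (Fin 1) (Fin n) ℝ}
    {Z : Matrix (Fin q) (Fin n) ℝ}
    (h : ∀ j : Fin (d.s + 1), ∫ τ in (d.t (2 * j))..(d.t (2 * j + 1)),
      (d.shifted Y τ ⬝ᵥ M *ᵥ d.shifted Y τ + d.u τ ⬝ᵥ N *ᵥ d.shifted Y τ
        + d.v τ ⬝ᵥ Z *ᵥ d.shifted Y τ) = 0) : M = 0 ∧ N = 0 ∧ Z = 0 := by
  -- Γ_{y,y} repeats the column of y_i y_j for i ≠ j. Replacing it by Λ_y removes the repetitions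
  -- but keeps the column space, so the rank condition says that `R` has full column rank, that is,
  -- it is injective.
  let R := fromCols (fromCols (d.Lam (d.shifted Y)) (d.Gam (d.shifted Y) d.u))
    (d.Gam (d.shifted Y) d.v)
  have hrow : ∀ (M : Matrix (Fin n) (Fin n) ℝ) (a : Fin n × Fin 1 → ℝ) (b : Fin n × Fin q → ℝ),
      fromCols (fromCols (d.Gam (d.shifted Y) (d.shifted Y)) (d.Gam (d.shifted Y) d.u))
        (d.Gam (d.shifted Y) d.v) *ᵥ Sum.elim (Sum.elim (vec M) a) b =
      R *ᵥ Sum.elim (Sum.elim (quadCoeff M) a) b := fun M a b => by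
    have h1 : d.Gam (d.shifted Y) (d.shifted Y) *ᵥ vec M
        = d.Lam (d.shifted Y) *ᵥ quadCoeff M := by
      funext j
      rw [Gam_mulVec_vec hyy, Lam_mulVec_quadCoeff hyy]
    simp only [R, fromCols_mulVec_sumElim, h1]
  have hrank : Fintype.card ((UpperIndex n ⊕ Fin n × Fin 1) ⊕ Fin n × Fin q) ≤ R.rank := by
    have hle : Module.finrank ℝ (LinearMap.range (fromCols
        (fromCols (d.Gam (d.shifted Y) (d.shifted Y)) (d.Gam (d.shifted Y) d.u))
        (d.Gam (d.shifted Y) d.v)).mulVecLin) ≤ Module.finrank ℝ (LinearMap.range R.mulVecLin) := by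
      refine Submodule.finrank_mono ?_
      rintro _ ⟨z, rfl⟩
      obtain ⟨M, hM⟩ := vec_bijective.2 (fun ij => z (.inl (.inl ij)))
      refine ⟨Sum.elim (Sum.elim (quadCoeff M) fun i => z (.inl (.inr i))) fun i => z (.inr i), ?_⟩
      rw [mulVecLin_apply, mulVecLin_apply, ← hrow, hM]
      congr 1
      funext i
      rcases i with (i | i) | i <;> rfl
    refine le_trans (le_of_eq ?_) hle
    rw [IsRichFor, Matrix.rank] at hr
    rw [hr, Fintype.card_sum, Fintype.card_sum, card_upperIndex]
    simp only [Fintype.card_prod, Fintype.card_fin]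
    ring
  have hinj : Function.Injective R.mulVecLin := by
    rw [← LinearMap.ker_eq_bot, ← Submodule.finrank_eq_zero]
    have := R.mulVecLin.finrank_range_add_finrank_ker
    rw [Module.finrank_pi] at this
    rw [Matrix.rank] at hrank
    omega
  have hz : R.mulVecLin (Sum.elim (Sum.elim (quadCoeff M) (vec N)) (vec Z)) = R.mulVecLin 0 := by
    rw [map_zero, mulVecLin_apply]
    simp only [R, fromCols_mulVec_sumElim]
    funext j
    rw [Pi.add_apply, Pi.add_apply, Lam_mulVec_quadCoeff hyy, Gam_mulVec_vec hyu,
      Gam_mulVec_vec hyv, Pi.zero_apply, ← h j,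
      intervalIntegral.integral_add ((hyy.bilin M j).add (hyu.bilin N j)) (hyv.bilin Z j),
      intervalIntegral.integral_add (hyy.bilin M j) (hyu.bilin N j)]
  have h0 := hinj hz
  refine ⟨eq_zero_of_vecs_eq_zero hM ?_, vec_eq_zero_iff.1 ?_, vec_eq_zero_iff.1 ?_⟩
  · rw [← quadCoeff_eq_vecs hM]
    funext i
    exact congrFun h0 (.inl (.inl i))
  · funext i
    exact congrFun h0 (.inl (.inr i))
  · funext i
    exact congrFun h0 (.inr i)

variable {p : Plant n q}

lemma IsGeneratedBy.t_nonneg (hd : d.IsGeneratedBy p) (j : ℕ) : 0 ≤ d.t j :=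
  hd.1.trans (hd.2.1.monotone (Nat.zero_le j))

lemma IsGeneratedBy.t_le (hd : d.IsGeneratedBy p) (j : ℕ) : d.t (2 * j) ≤ d.t (2 * j + 1) :=
  hd.2.1.monotone (Nat.le_succ _)

lemma IsGeneratedBy.shifted (hd : d.IsGeneratedBy p) (Y : Matrix (Fin n) (Fin q) ℝ)
    (j : Fin (d.s + 1)) :
    (p.shift Y).IsTrajectoryOn (d.shifted Y) d.u d.v (d.t (2 * j)) (d.t (2 * j + 1)) :=
  (hd.2.2.2 j (Nat.lt_succ_iff.1 j.2)).2.shift (hd.t_nonneg _) (hd.t_le _) hd.2.2.1 Y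

lemma productsIntegrable {k m : ℕ} {a : ℝ → Fin k → ℝ} {b : ℝ → Fin m → ℝ}
    (ht : ∀ j, d.t (2 * j) ≤ d.t (2 * j + 1))
    (ha : ∀ j : Fin (d.s + 1), ContinuousOn a (Icc (d.t (2 * j)) (d.t (2 * j + 1))))
    (hb : ∀ j : Fin (d.s + 1), IntervalIntegrable b volume (d.t (2 * j)) (d.t (2 * j + 1))) :
    d.ProductsIntegrable a b := fun j i l => by
  refine ((hb j).apply l).continuousOn_mul ?_
  rw [uIcc_of_le (ht j)]
  exact continuousOn_pi.1 (ha j) i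

lemma intervalIntegrable_of_continuousOn {k : ℕ} {a : ℝ → Fin k → ℝ}
    (ht : ∀ j, d.t (2 * j) ≤ d.t (2 * j + 1))
    (ha : ∀ j : Fin (d.s + 1), ContinuousOn a (Icc (d.t (2 * j)) (d.t (2 * j + 1))))
    (j : Fin (d.s + 1)) : IntervalIntegrable a volume (d.t (2 * j)) (d.t (2 * j + 1)) := by
  refine ContinuousOn.intervalIntegrable ?_
  rw [uIcc_of_le (ht j)]
  exact ha j

/-- On rich data, a solution of the regression of the second phase solves the corresponding
Lyapunov equation, and its other components are determined by the plant. -/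
lemma IsRichFor.of_regression (hd : d.IsGeneratedBy p) {Y : Matrix (Fin n) (Fin q) ℝ}
    (hr : d.IsRichFor Y) {lam : ℝ} {Q P : Matrix (Fin n) (Fin n) ℝ} (hQ : Q.IsSymm)
    (hP : P.IsSymm) {K G : Matrix (Fin 1) (Fin n) ℝ} {Z : Matrix (Fin q) (Fin n) ℝ}
    (h : d.PsiPI lam Y K *ᵥ unknowns P G Z = d.PhiPI Q Y K) :
    p.Aᵀ * P + P * p.A + (2 * lam) • P - (Kᵀ * G + Gᵀ * K) + (Q + Kᵀ * K) = 0 ∧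
      G = p.Bᵀ * P ∧ Z = (p.D + p.A * Y - Y * p.S)ᵀ * P := by
  have htr := hd.shifted Y
  have hyc := fun j => (htr j).1
  have hvc : ∀ j : Fin (d.s + 1), ContinuousOn d.v (Icc (d.t (2 * j)) (d.t (2 * j + 1))) :=
    fun j => hd.2.2.1.continuousOn (hd.t_nonneg _)
  have hyy : d.ProductsIntegrable (d.shifted Y) (d.shifted Y) :=
    productsIntegrable hd.t_le hyc (intervalIntegrable_of_continuousOn hd.t_le hyc)
  have hyu : d.ProductsIntegrable (d.shifted Y) d.u :=
    productsIntegrable hd.t_le hyc fun j => (htr j).2.1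
  have hyv : d.ProductsIntegrable (d.shifted Y) d.v :=
    productsIntegrable hd.t_le hyc (intervalIntegrable_of_continuousOn hd.t_le hvc)
  -- A quadratic form sees only the symmetric part of its matrix, hence the symmetrized Kᵀ G + Gᵀ K
  -- in place of 2 Kᵀ G.
  have hM : (p.Aᵀ * P + P * p.A + (2 * lam) • P - (Kᵀ * G + Gᵀ * K) + (Q + Kᵀ * K)).IsSymm := by
    simp only [Matrix.IsSymm, transpose_add, transpose_sub, transpose_mul, transpose_transpose,
      transpose_smul, hP.eq, hQ.eq]
    abel
  have key : ∀ j : Fin (d.s + 1), ∫ τ in (d.t (2 * j))..(d.t (2 * j + 1)),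
      (d.shifted Y τ ⬝ᵥ (p.Aᵀ * P + P * p.A + (2 * lam) • P - (Kᵀ * G + Gᵀ * K)
          + (Q + Kᵀ * K)) *ᵥ d.shifted Y τ
        + d.u τ ⬝ᵥ ((2 : ℝ) • (p.Bᵀ * P - G)) *ᵥ d.shifted Y τ
        + d.v τ ⬝ᵥ ((2 : ℝ) • ((p.D + p.A * Y - Y * p.S)ᵀ * P - Z)) *ᵥ d.shifted Y τ) = 0 := by
    intro j
    have hj := congrFun h j
    have hkr : ((1 : Matrix (Fin n) (Fin n) ℝ) ⊗ₖ Kᵀ) *ᵥ vec G = vec (Kᵀ * G) := by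
      rw [kronecker_mulVec_vec, transpose_one, Matrix.mul_one]
    simp only [PsiPI, PhiPI, unknowns, fromCols_mulVec_sumElim, add_mulVec, sub_mulVec, smul_mulVec,
      ← mulVec_mulVec, hkr, Pi.add_apply, Pi.sub_apply, Pi.smul_apply, Pi.neg_apply,
      smul_eq_mul] at hj
    rw [← quadCoeff_eq_vecs hP, Lam_mulVec_quadCoeff hyy, quadCoeff_eq_vecs hP,
      delta_mulVec_vecs hP, Gam_mulVec_vec hyy, Gam_mulVec_vec hyu, Gam_mulVec_vec hyv,
      Gam_mulVec_vec hyy, (htr j).quad_sub_quad (hd.t_le j) (hvc j) hP] at hj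
    -- All integrals are rewritten as Γ applied to `vec` of a matrix. This is linear in the matrix,
    -- so the claim becomes linear arithmetic.
    have i1 := hyy.bilin ((p.shift Y).Aᵀ * P + P * (p.shift Y).A) j
    have i2 := (hyu.bilin ((p.shift Y).Bᵀ * P) j).const_mul 2
    have i3 := (hyv.bilin ((p.shift Y).Dᵀ * P) j).const_mul 2
    rw [intervalIntegral.integral_add (i1.add i2) i3, intervalIntegral.integral_add i1 i2,
      intervalIntegral.integral_const_mul, intervalIntegral.integral_const_mul,
      ← Gam_mulVec_vec hyy, ← Gam_mulVec_vec hyu, ← Gam_mulVec_vec hyv, ← Gam_mulVec_vec hyy,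
      ← Gam_mulVec_vec hyy, ← Gam_mulVec_vec hyu, ← Gam_mulVec_vec hyv, ← Gam_mulVec_vec hyy] at hj
    have hsym : (d.Gam (d.shifted Y) (d.shifted Y) *ᵥ vec (Gᵀ * K)) j
        = (d.Gam (d.shifted Y) (d.shifted Y) *ᵥ vec (Kᵀ * G)) j := by
      rw [Gam_mulVec_vec hyy, Gam_mulVec_vec hyy]
      refine intervalIntegral.integral_congr fun s _ => ?_
      rw [← mulVec_mulVec, ← mulVec_mulVec, dotProduct_mulVec _ Gᵀ, dotProduct_mulVec _ Kᵀ,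
        vecMul_transpose, vecMul_transpose, dotProduct_comm]
    rw [intervalIntegral.integral_add ((hyy.bilin _ j).add (hyu.bilin _ j)) (hyv.bilin _ j),
      intervalIntegral.integral_add (hyy.bilin _ j) (hyu.bilin _ j),
      ← Gam_mulVec_vec hyy, ← Gam_mulVec_vec hyu, ← Gam_mulVec_vec hyv]
    simp only [vec_add, vec_sub, vec_smul, mulVec_add, mulVec_sub, mulVec_smul, Pi.add_apply,
      Pi.sub_apply, Pi.smul_apply, smul_eq_mul, hsym, Plant.shift] at hj ⊢
    linarith
  obtain ⟨h1, h2, h3⟩ := hr.eq_zero hyy hyu hyv hM key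
  refine ⟨h1, ?_, ?_⟩
  · exact (sub_eq_zero.1 ((smul_eq_zero_iff_right two_ne_zero).1 h2)).symm
  · exact (sub_eq_zero.1 ((smul_eq_zero_iff_right two_ne_zero).1 h3)).symm

lemma shifted_zero : d.shifted 0 = d.x := by
  funext τ
  simp [Experiment.shifted]

/-- On rich data, the first phase finds a solution of a Lyapunov equation of `A - λ⁺ I`. -/
lemma IsRichFor.of_growth_regression (hd : d.IsGeneratedBy p) (hr : d.IsRichFor 0) {lam ε : ℝ}
    {P : Matrix (Fin n) (Fin n) ℝ} (hP : P.IsSymm) {G : Matrix (Fin 1) (Fin n) ℝ}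
    {Z : Matrix (Fin q) (Fin n) ℝ} (h : d.Psi lam *ᵥ unknowns P G Z = d.Phi ε) :
    p.Aᵀ * P + P * p.A = (2 * lam) • P - ε • 1 := by
  -- The first phase is the second-phase regression with rate -λ⁺, gain 0 and weight ε I.
  have h1 : d.PsiPI (-lam) 0 0 *ᵥ unknowns P G Z =
      d.PhiPI (ε • (1 : Matrix (Fin n) (Fin n) ℝ)) 0 0 := by
    have e1 : d.PsiPI (-lam) 0 0 = d.Psi lam := by
      have hk : (1 : Matrix (Fin n) (Fin n) ℝ) ⊗ₖ (0 : Matrix (Fin 1) (Fin n) ℝ)ᵀ = 0 := by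
        rw [transpose_zero, kronecker_zero]
      simp only [PsiPI, Psi, shifted_zero, hk, Matrix.mul_zero, smul_zero, mul_neg,
        neg_smul, sub_eq_add_neg, zero_add]
    rw [e1, h]
    simp only [PhiPI, Phi, shifted_zero, Matrix.mul_zero, add_zero, vec_smul, mulVec_smul]
  obtain ⟨h2, -, -⟩ := hr.of_regression hd (isSymm_one.smul ε) hP h1
  simp only [transpose_zero, Matrix.zero_mul, Matrix.mul_zero, add_zero, sub_zero, mul_neg,
    neg_smul] at h2
  rw [← sub_eq_zero, ← h2]
  abel

end Experiment

end Regression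

/-! ### Policy iteration -/

section PolicyIteration

variable {n q : ℕ} {p : Plant n q} {d : Experiment n q}

lemma posDef_add_transpose_mul_self {m : ℕ} {Q : Matrix (Fin n) (Fin n) ℝ} (hQ : Q.PosDef)
    (K : Matrix (Fin m) (Fin n) ℝ) : (Q + Kᵀ * K).PosDef := by
  have h := posSemidef_conjTranspose_mul_self K
  rw [conjTranspose_eq_transpose_of_trivial] at h
  exact hQ.add_posSemidef h

/-- The gain enters only through the last bracket, where Bᵀ P is the improved gain; this allows the
same P to be tested on two successive gains. -/
lemma lyapunov_closedLoop {P : Matrix (Fin n) (Fin n) ℝ} (hP : P.IsSymm)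
    (A : Matrix (Fin n) (Fin n) ℝ) (B : Matrix (Fin n) (Fin 1) ℝ) (K : Matrix (Fin 1) (Fin n) ℝ)
    (lam : ℝ) :
    (A - B * K + lam • 1)ᵀ * P + P * (A - B * K + lam • 1) =
      Aᵀ * P + P * A + (2 * lam) • P - (Kᵀ * (Bᵀ * P) + (Bᵀ * P)ᵀ * K) := by
  simp only [transpose_add, transpose_sub, transpose_mul, transpose_smul, transpose_one,
    transpose_transpose, Matrix.add_mul, Matrix.sub_mul, Matrix.mul_add, Matrix.mul_sub,
    Matrix.smul_mul, Matrix.mul_smul, Matrix.one_mul, Matrix.mul_one, hP.eq, ← Matrix.mul_assoc,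
    two_mul, add_smul]
  abel

/-- For an admissible gain, the trajectories of the closed loop with shifted spectrum are square
integrable. -/
lemma Plant.IsAdmissible.integrableOn {Q : Matrix (Fin n) (Fin n) ℝ} {lam : ℝ}
    {K : Matrix (Fin 1) (Fin n) ℝ} (hK : p.IsAdmissible Q lam K) (hQ : Q.PosDef)
    {ζ : ℝ → Fin n → ℝ} (hζ : ∀ t, HasDerivAt ζ ((p.A - p.B * K + lam • 1) *ᵥ ζ t) t) :
    IntegrableOn (fun t => ζ t ⬝ᵥ Q *ᵥ ζ t) (Ioi 0) := by
  -- Multiplying by e^{-λt} undoes the spectral shift, and the weight e^{2λt} of the cost cancels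
  -- the two factors e^{-λt}.
  have hξ : ∀ t, 0 ≤ t → HasDerivWithinAt (fun t => Real.exp (-lam * t) • ζ t)
      ((p.A - p.B * K) *ᵥ (Real.exp (-lam * t) • ζ t)) (Ici 0) t := fun t _ => by
    have h1 : HasDerivAt (fun t => Real.exp (-lam * t)) (Real.exp (-lam * t) * -lam) t := by
      simpa using ((hasDerivAt_id t).const_mul (-lam)).exp
    refine ((h1.smul (hζ t)).congr_deriv ?_).hasDerivWithinAt
    rw [add_mulVec, smul_mulVec, one_mulVec, mulVec_smul]
    module
  have hcont : Continuous ζ := continuous_iff_continuousAt.2 fun t => (hζ t).continuousAt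
  refine (hK.2 _ hξ).mono' (by fun_prop) (.of_forall fun t => ?_)
  rw [Real.norm_of_nonneg (hQ.quad_nonneg _), quad_smul, mulVec_smul, smul_dotProduct,
    dotProduct_smul, smul_eq_mul, smul_eq_mul, ← mul_assoc (Real.exp _), ← sq, ← mul_add,
    ← mul_assoc, sq, ← Real.exp_add, ← Real.exp_add,
    show 2 * t * lam + (-lam * t + -lam * t) = 0 by ring, Real.exp_zero, one_mul]
  have : 0 ≤ (K *ᵥ ζ t) ⬝ᵥ (K *ᵥ ζ t) := by
    rw [← euclNorm_sq]
    positivity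
  linarith

variable {Q : Matrix (Fin n) (Fin n) ℝ} {lam : ℝ} {N : ℕ} {P : ℕ → Matrix (Fin n) (Fin n) ℝ}
  {K : ℕ → Matrix (Fin 1) (Fin n) ℝ}

namespace IsPolicyIteration

lemma improvement (h : IsPolicyIteration p d Q lam N P K) (hd : d.IsGeneratedBy p)
    (hr : d.IsRichFor 0) (hQ : Q.PosDef) {k : ℕ} (hk : k ≤ N) : K (k + 1) = p.Bᵀ * P k := by
  obtain ⟨Z, hZ⟩ := h.solves k hk
  exact (hr.of_regression hd hQ.isSymm (h.symm k hk) hZ).2.1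

/-- Policy evaluation: the Lyapunov equation of the current gain. -/
lemma evaluation (h : IsPolicyIteration p d Q lam N P K) (hd : d.IsGeneratedBy p)
    (hr : d.IsRichFor 0) (hQ : Q.PosDef) {k : ℕ} (hk : k ≤ N) :
    (p.A - p.B * K k + lam • 1)ᵀ * P k + P k * (p.A - p.B * K k + lam • 1) =
      -(Q + (K k)ᵀ * K k) := by
  obtain ⟨Z, hZ⟩ := h.solves k hk
  have h1 := (hr.of_regression hd hQ.isSymm (h.symm k hk) hZ).1
  rw [lyapunov_closedLoop (h.symm k hk), ← h.improvement hd hr hQ hk]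
  exact eq_neg_of_add_eq_zero_left h1

/-- The value of a gain is a Lyapunov function for the improved gain. -/
lemma evaluation_succ (h : IsPolicyIteration p d Q lam N P K) (hd : d.IsGeneratedBy p)
    (hr : d.IsRichFor 0) (hQ : Q.PosDef) {k : ℕ} (hk : k ≤ N) :
    (p.A - p.B * K (k + 1) + lam • 1)ᵀ * P k + P k * (p.A - p.B * K (k + 1) + lam • 1) =
      -(Q + (K k - K (k + 1))ᵀ * (K k - K (k + 1)) + (K (k + 1))ᵀ * K (k + 1)) := by
  have h1 := h.evaluation hd hr hQ hk
  rw [lyapunov_closedLoop (h.symm k hk), ← h.improvement hd hr hQ hk] at h1 ⊢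
  rw [sub_eq_iff_eq_add] at h1
  rw [h1]
  -- Completion of the square, with G the improved gain: Kᵀ G + Gᵀ K - Kᵀ K - 2 Gᵀ G = -(K - G)ᵀ(K -
  -- G) - Gᵀ G.
  simp only [transpose_sub, Matrix.sub_mul, Matrix.mul_sub]
  abel

/-- Admissibility starts the induction. In the step, P_k and P_{k+1} both solve Lyapunov equations
of the loop with gain K_{k+1}, so `posDef_of_lyapunov_of_lyapunov` transfers positivity. -/
lemma posDef (h : IsPolicyIteration p d Q lam N P K) (hd : d.IsGeneratedBy p)
    (hr : d.IsRichFor 0) (hQ : Q.PosDef) {k : ℕ} (hk : k ≤ N) : (P k).PosDef := by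
  induction k with
  | zero =>
    exact posDef_of_lyapunov_of_integrable (h.symm 0 hk) (posDef_add_transpose_mul_self hQ _)
      (h.evaluation hd hr hQ hk) hQ fun ζ hζ => h.admissible.integrableOn hQ hζ
  | succ k ih =>
    exact posDef_of_lyapunov_of_lyapunov (h.symm _ hk) (posDef_add_transpose_mul_self hQ _)
      (h.evaluation hd hr hQ hk) (ih (by omega))
      (posDef_add_transpose_mul_self (posDef_add_transpose_mul_self hQ _) _)
      (h.evaluation_succ hd hr hQ (by omega))

end IsPolicyIteration

end PolicyIteration

/-! ### Regulator equations -/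

section RegulatorEquations

variable {n q : ℕ} {p : Plant n q} {d : Experiment n q} {Q P : Matrix (Fin n) (Fin n) ℝ} {lam : ℝ}
  {Xt : ℕ → Matrix (Fin n) (Fin q) ℝ} {K Knew : Matrix (Fin 1) (Fin n) ℝ}
  {X : Matrix (Fin n) (Fin q) ℝ} {U : Matrix (Fin 1) (Fin q) ℝ}

lemma IsTrialFamily.mul_eq_zero (h : IsTrialFamily p Xt) (j : Fin ((n - 1) * q)) :
    p.C * Xt (j + 2) = 0 := by
  have h1 : vec (Xt (j + 2)) ∈
      LinearMap.ker ((1 : Matrix (Fin q) (Fin q) ℝ) ⊗ₖ p.C).mulVecLin := by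
    rw [← h.span]
    exact Submodule.subset_span ⟨j, rfl⟩
  rw [LinearMap.mem_ker, mulVecLin_apply, kronecker_mulVec_vec, transpose_one, Matrix.mul_one] at h1
  exact vec_eq_zero_iff.1 h1

lemma IsLearnedRegulator.output_eq (h : IsLearnedRegulator d Q lam Xt P K Knew X U)
    (hXt : IsTrialFamily p Xt) : p.C * X = -p.F := by
  obtain ⟨Bh, Dh, Sh, α, -, -, -, hX, -⟩ := h
  rw [hX, Matrix.mul_add, hXt.one, Matrix.mul_sum]
  simp [hXt.mul_eq_zero]

lemma mul_right_cancel_of_posDef (hP : P.PosDef) {m : ℕ} {M N : Matrix (Fin m) (Fin n) ℝ}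
    (h : M * P = N * P) : M = N := by
  have hu : IsUnit P.det := (Matrix.isUnit_iff_isUnit_det _).1 hP.isUnit
  have h1 := congrArg (· * P⁻¹) h
  simpa [Matrix.mul_assoc, Matrix.mul_nonsing_inv _ hu] using h1

/-- Invertibility of P lets the regressions identify B̂ = B and D̂ - Ŝ_i = D + A X_i - X_i S. The
index i = 0 gives D̂ = D, hence Ŝ_i = X_i S - A X_i. This is linear in X_i, so the combination
defining X turns the learned equation into the true one. -/
lemma IsLearnedRegulator.sylvester_eq (h : IsLearnedRegulator d Q lam Xt P K Knew X U)
    (hXt : IsTrialFamily p Xt) (hd : d.IsGeneratedBy p)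
    (hr : ∀ i ≤ (n - 1) * q + 1, d.IsRichFor (Xt i)) (hQ : Q.PosDef) (hP : P.PosDef) :
    X * p.S = p.A * X + p.B * U + p.D := by
  obtain ⟨Bh, Dh, Sh, α, hK, hS0, hreg, hX, hXU⟩ := h
  have hD : ∀ i ≤ (n - 1) * q + 1, Dh - Sh i = p.D + p.A * Xt i - Xt i * p.S := fun i hi =>
    transpose_injective <| mul_right_cancel_of_posDef hP
      ((hr i hi).of_regression hd hQ.isSymm hP.isSymm (hreg i hi)).2.2
  have hB : Bh = p.B := transpose_injective <| mul_right_cancel_of_posDef hP <| by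
    rw [← hK]
    exact ((hr 0 (Nat.zero_le _)).of_regression hd hQ.isSymm hP.isSymm
      (hreg 0 (Nat.zero_le _))).2.1
  have hD0 : Dh = p.D := by
    simpa [hS0, hXt.zero] using hD 0 (Nat.zero_le _)
  have hS : ∀ i ≤ (n - 1) * q + 1, Sh i = Xt i * p.S - p.A * Xt i := fun i hi => by
    have h1 := hD i hi
    rw [hD0, sub_eq_iff_eq_add] at h1
    have h2 : p.D + (p.A * Xt i - Xt i * p.S + Sh i) = p.D + 0 := by
      rw [add_zero]
      conv_rhs => rw [h1]
      abel
    have h3 := add_left_cancel h2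
    rw [← sub_eq_zero, ← h3]
    abel
  have hsum : ∑ j, α j • Sh (j + 2) =
      (∑ j, α j • Xt (j + 2)) * p.S - p.A * ∑ j, α j • Xt (j + 2) := by
    rw [Matrix.sum_mul, Matrix.mul_sum, ← Finset.sum_sub_distrib]
    refine Finset.sum_congr rfl fun j _ => ?_
    rw [hS (j + 2) (by omega), smul_sub, Matrix.smul_mul, Matrix.mul_smul]
  rw [hS 1 (by omega), hsum, hB, hD0] at hXU
  rw [hX, add_assoc (p.A * _), ← hXU, Matrix.add_mul, Matrix.mul_add]
  abel

end RegulatorEquations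

/-! ### Switched systems -/

section Switching

/-- Without frontier points the interval is covered by the disjoint open sets `interior D` and
`interior Dᶜ`, and it is connected. -/
lemma Ioo_subset_or_disjoint {D : Set ℝ} {a b : ℝ} (h : Ioo a b ∩ frontier D = ∅) :
    Ioo a b ⊆ D ∨ Disjoint (Ioo a b) D := by
  have hcov : Ioo a b ⊆ interior D ∪ interior Dᶜ := fun t ht => by
    have h1 : t ∉ frontier D := fun h2 => (h ▸ ⟨ht, h2⟩ : t ∈ (∅ : Set ℝ))
    rw [interior_compl]
    by_cases h2 : t ∈ closure D
    · exact .inl (by_contra fun h3 => h1 ⟨h2, h3⟩)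
    · exact .inr h2
  have hdisj : Disjoint (interior D) (interior Dᶜ) :=
    disjoint_compl_right.mono interior_subset interior_subset
  rcases isPreconnected_Ioo.subset_or_subset isOpen_interior isOpen_interior hdisj hcov with h1 | h1
  · exact .inl (h1.trans interior_subset)
  · exact .inr (disjoint_compl_left.mono_left (h1.trans interior_subset))

/-- Energy bound for a system that switches between two modes, `D` being the set of times in the
mode `true`: every change of mode costs at most a factor `g`. -/
lemma switched_energy_bound {D : Set ℝ} (hD : MeasurableSet D) {W : Bool → ℝ → ℝ} {g ρ ρ' : ℝ}
    (hg : 0 ≤ g) (hjump : ∀ i j t, W i t ≤ g * W j t)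
    (htrue : ∀ a b, 0 ≤ a → a < b → Ioo a b ⊆ D →
      W true b ≤ Real.exp (ρ' * (b - a)) * W true a)
    (hfalse : ∀ a b, 0 ≤ a → a < b → Disjoint (Ioo a b) D →
      W false b ≤ Real.exp (-ρ * (b - a)) * W false a)
    {a b : ℝ} (ha : 0 ≤ a) (hab : a < b) (hfin : (Ioo a b ∩ frontier D).Finite) :
    ∃ i j, W j b ≤ g ^ (Ioo a b ∩ frontier D).ncard *
      Real.exp (-ρ * ((b - a) - volume.real (Ioo a b ∩ D)) + ρ' * volume.real (Ioo a b ∩ D)) *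
        W i a := by
  induction hm : (Ioo a b ∩ frontier D).ncard using Nat.strong_induction_on generalizing a b with
  | _ m ih =>
  -- The modes i and j at the two ends are left existential: they are those of the outermost
  -- subintervals, whatever the status at the endpoints themselves.
  rcases (Ioo a b ∩ frontier D).eq_empty_or_nonempty with he | ⟨f, hf, hfD⟩
  · rw [he, ncard_empty] at hm
    subst hm
    rcases Ioo_subset_or_disjoint he with h | h
    · refine ⟨true, true, ?_⟩
      rw [inter_eq_left.2 h, Real.volume_real_Ioo_of_le hab.le]
      simpa using htrue a b ha hab h
    · refine ⟨false, false, ?_⟩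
      rw [h.inter_eq]
      simpa using hfalse a b ha hab h
  · have hsplit : Ioo a b ∩ frontier D =
        insert f ((Ioo a f ∩ frontier D) ∪ (Ioo f b ∩ frontier D)) := by
      ext t
      simp only [mem_inter_iff, mem_insert_iff, mem_union, mem_Ioo]
      constructor
      · rintro ⟨⟨h1, h2⟩, h3⟩
        rcases lt_trichotomy t f with h | h | h
        · exact .inr (.inl ⟨⟨h1, h⟩, h3⟩)
        · exact .inl h
        · exact .inr (.inr ⟨⟨h, h2⟩, h3⟩)
      · rintro (rfl | ⟨⟨h1, h2⟩, h3⟩ | ⟨⟨h1, h2⟩, h3⟩)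
        · exact ⟨hf, hfD⟩
        · exact ⟨⟨h1, h2.trans hf.2⟩, h3⟩
        · exact ⟨⟨hf.1.trans h1, h2⟩, h3⟩
    have hfin1 : (Ioo a f ∩ frontier D).Finite :=
      hfin.subset (inter_subset_inter_left _ (Ioo_subset_Ioo_right hf.2.le))
    have hfin2 : (Ioo f b ∩ frontier D).Finite :=
      hfin.subset (inter_subset_inter_left _ (Ioo_subset_Ioo_left hf.1.le))
    have hcard : (Ioo a f ∩ frontier D).ncard + (Ioo f b ∩ frontier D).ncard + 1 = m := by
      rw [← hm, hsplit, ncard_insert_of_notMem (by simp) (hfin1.union hfin2),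
        ncard_union_eq _ hfin1 hfin2]
      refine disjoint_left.2 fun t h1 h2 => ?_
      exact lt_asymm h1.1.2 h2.1.1
    have hvol : volume.real (Ioo a b ∩ D) =
        volume.real (Ioo a f ∩ D) + volume.real (Ioo f b ∩ D) := by
      have hae : (Ioo a b ∩ D : Set ℝ) =ᵐ[volume] ((Ioo a f ∩ D) ∪ (Ioo f b ∩ D) : Set ℝ) := by
        filter_upwards [compl_mem_ae_iff.2 (measure_singleton f)] with t ht
        refine propext ?_
        change (t ∈ Ioo a b ∧ t ∈ D) ↔ (t ∈ Ioo a f ∧ t ∈ D) ∨ (t ∈ Ioo f b ∧ t ∈ D)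
        simp only [mem_Ioo]
        constructor
        · rintro ⟨⟨h1, h2⟩, h3⟩
          rcases lt_or_gt_of_ne (show t ≠ f from ht) with h | h
          · exact .inl ⟨⟨h1, h⟩, h3⟩
          · exact .inr ⟨⟨h, h2⟩, h3⟩
        · rintro (⟨⟨h1, h2⟩, h3⟩ | ⟨⟨h1, h2⟩, h3⟩)
          · exact ⟨⟨h1, h2.trans hf.2⟩, h3⟩
          · exact ⟨⟨hf.1.trans h1, h2⟩, h3⟩
      rw [measureReal_congr hae, measureReal_union _ (measurableSet_Ioo.inter hD)
        (measure_inter_lt_top_of_left_ne_top (by simp)).ne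
        (measure_inter_lt_top_of_left_ne_top (by simp)).ne]
      refine disjoint_left.2 fun t h1 h2 => ?_
      exact lt_asymm h1.1.2 h2.1.1
    obtain ⟨i, j, h1⟩ := ih _ (by omega) ha hf.1 hfin1 rfl
    obtain ⟨i', j', h2⟩ := ih _ (by omega) (ha.trans hf.1.le) hf.2 hfin2 rfl
    -- At the cut f the energy of the left piece is exchanged for that of the right piece, which
    -- costs the one factor g assigned to f.
    refine ⟨i, j', h2.trans ((mul_le_mul_of_nonneg_left ((hjump i' j f).trans
      (mul_le_mul_of_nonneg_left h1 (by positivity))) (by positivity)).trans_eq ?_)⟩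
    rw [← hcard, hvol, pow_succ, pow_add]
    rw [show -ρ * (b - a - (volume.real (Ioo a f ∩ D) + volume.real (Ioo f b ∩ D))) +
        ρ' * (volume.real (Ioo a f ∩ D) + volume.real (Ioo f b ∩ D)) =
        (-ρ * (f - a - volume.real (Ioo a f ∩ D)) + ρ' * volume.real (Ioo a f ∩ D)) +
        (-ρ * (b - f - volume.real (Ioo f b ∩ D)) + ρ' * volume.real (Ioo f b ∩ D)) by ring,
      Real.exp_add (-ρ * (f - a - volume.real (Ioo a f ∩ D)) + _)]
    ac_rfl

variable {n : ℕ}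

/-- Exponential bound for a quadratic energy along a trajectory of `z' = M z`. -/
lemma quad_le_exp_mul_quad {P M : Matrix (Fin n) (Fin n) ℝ} (hP : P.IsSymm) {ρ : ℝ}
    (hM : ∀ x, 2 * ((M *ᵥ x) ⬝ᵥ P *ᵥ x) ≤ ρ * (x ⬝ᵥ P *ᵥ x)) {z w : ℝ → Fin n → ℝ} {a b : ℝ}
    (hab : a ≤ b) (hzc : ContinuousOn z (Icc a b))
    (hz : ∀ t ∈ Icc a b, z t = z a + ∫ s in a..t, w s) (hw : ∀ t ∈ Ioo a b, w t = M *ᵥ z t) :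
    z b ⬝ᵥ P *ᵥ z b ≤ Real.exp (ρ * (b - a)) * (z a ⬝ᵥ P *ᵥ z a) := by
  -- The velocity is prescribed only on the open interval; endpoints are null, and with a continuous
  -- integrand z becomes differentiable inside.
  have hz' : ∀ t ∈ Icc a b, z t = z a + ∫ s in a..t, M *ᵥ z s := fun t ht => by
    rw [hz t ht]
    congr 1
    refine intervalIntegral.integral_congr_ae ?_
    filter_upwards [compl_mem_ae_iff.2 (measure_singleton b)] with s hs hst
    rw [uIoc_of_le ht.1] at hst
    exact hw s ⟨hst.1, lt_of_le_of_ne (hst.2.trans ht.2) hs⟩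
  have hMc : ContinuousOn (fun s => M *ᵥ z s) (Icc a b) := by fun_prop
  have hd : ∀ t ∈ Ioo a b, HasDerivAt z (M *ᵥ z t) t := fun t ht => by
    have h1 : HasDerivAt (fun t => ∫ s in a..t, M *ᵥ z s) (M *ᵥ z t) t := by
      refine intervalIntegral.integral_hasDerivAt_right ?_ ?_ ?_
      · refine (hMc.mono ?_).intervalIntegrable
        rw [uIcc_of_le ht.1.le]
        exact Icc_subset_Icc_right ht.2.le
      · exact (hMc.mono Ioo_subset_Icc_self).stronglyMeasurableAtFilter isOpen_Ioo t ht
      · exact hMc.continuousAt (Icc_mem_nhds ht.1 ht.2)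
    refine (h1.const_add (z a)).congr_of_eventuallyEq ?_
    filter_upwards [Icc_mem_nhds ht.1 ht.2] with s hs using hz' s hs
  have hanti : AntitoneOn (fun t => Real.exp (-ρ * (t - a)) * (z t ⬝ᵥ P *ᵥ z t)) (Icc a b) := by
    have hderiv : ∀ t ∈ Ioo a b, HasDerivAt (fun t => Real.exp (-ρ * (t - a)) * (z t ⬝ᵥ P *ᵥ z t))
        (Real.exp (-ρ * (t - a)) * -ρ * (z t ⬝ᵥ P *ᵥ z t) +
          Real.exp (-ρ * (t - a)) * (2 * ((M *ᵥ z t) ⬝ᵥ P *ᵥ z t))) t := fun t ht => by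
      have h1 : HasDerivAt (fun t => Real.exp (-ρ * (t - a))) (Real.exp (-ρ * (t - a)) * -ρ) t := by
        simpa using (((hasDerivAt_id t).sub_const a).const_mul (-ρ)).exp
      exact h1.mul (hasDerivAt_quad hP (hd t ht))
    refine antitoneOn_of_deriv_nonpos (convex_Icc a b) (by fun_prop) ?_ ?_
    · rw [interior_Icc]
      exact fun t ht => (hderiv t ht).differentiableAt.differentiableWithinAt
    · rw [interior_Icc]
      intro t ht
      rw [(hderiv t ht).deriv]
      have h1 := mul_le_mul_of_nonneg_left (hM (z t)) (Real.exp_pos (-ρ * (t - a))).le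
      linarith
  have h1 := hanti (left_mem_Icc.2 hab) (right_mem_Icc.2 hab) hab
  simp only [sub_self, mul_zero, Real.exp_zero, one_mul] at h1
  have h2 := mul_le_mul_of_nonneg_left h1 (Real.exp_pos (ρ * (b - a))).le
  rwa [← mul_assoc, ← Real.exp_add, neg_mul, add_neg_cancel, Real.exp_zero, one_mul] at h2

end Switching

/-! ### Exponential stability under attacks -/

section Resilience

variable {n q : ℕ}

lemma DoSAttack.measurableSet_denied (a : DoSAttack) : MeasurableSet a.denied :=
  .iUnion fun _ => measurableSet_Ico

/-- With the weight `c`, the quadratic forms of `P` and `P'` differ at most by the factor `g`, the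
square root of the product of their condition numbers. -/
lemma exists_balancing_weight [NeZero n] {P P' : Matrix (Fin n) (Fin n) ℝ} (hP : P.PosDef)
    (hP' : P'.PosDef) : ∃ c > 0, ∃ g ≥ 1,
      2 * Real.log g = Real.log ((lambdaMax P * lambdaMax P') / (lambdaMin P * lambdaMin P')) ∧
      (∀ x, x ⬝ᵥ P' *ᵥ x ≤ g * (c * (x ⬝ᵥ P *ᵥ x))) ∧
      (∀ x, c * (x ⬝ᵥ P *ᵥ x) ≤ g * (x ⬝ᵥ P' *ᵥ x)) := by
  have hm := lambdaMin_pos hP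
  have hm' := lambdaMin_pos hP'
  have hM := lambdaMin_le_lambdaMax hP
  have hM' := lambdaMin_le_lambdaMax hP'
  have root : ∀ r : ℝ, 0 < r → ∃ s, 0 < s ∧ s ^ 2 = r :=
    fun r hr => ⟨√r, Real.sqrt_pos.2 hr, Real.sq_sqrt hr.le⟩
  obtain ⟨m, hm0, hm2⟩ := root _ hm
  obtain ⟨m', hm0', hm2'⟩ := root _ hm'
  obtain ⟨M, hM0, hM2⟩ := root _ (hm.trans_le hM)
  obtain ⟨M', hM0', hM2'⟩ := root _ (hm'.trans_le hM')
  have hmM : m ≤ M := by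
    rw [← hm2, ← hM2] at hM
    exact le_of_sq_le_sq hM hM0.le
  have hmM' : m' ≤ M' := by
    rw [← hm2', ← hM2'] at hM'
    exact le_of_sq_le_sq hM' hM0'.le
  -- Passing from P' to P costs M'²/m², and from P to P' costs M²/m'². The weight is the square root
  -- of their quotient, so that both costs become the square root g of their product.
  refine ⟨M' * m' / (m * M), by positivity, M * M' / (m * m'), ?_, ?_, fun x => ?_, fun x => ?_⟩
  · rw [ge_iff_le, one_le_div (by positivity)]
    exact mul_le_mul hmM hmM' hm0'.le hM0.le
  · rw [← hm2, ← hm2', ← hM2, ← hM2', ← mul_pow, ← mul_pow, ← div_pow, Real.log_pow]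
    norm_num
  · have h1 := quad_le_lambdaMax hP' x
    have h2 := lambdaMin_le_quad hP x
    rw [← hM2'] at h1
    rw [← hm2] at h2
    calc x ⬝ᵥ P' *ᵥ x ≤ M' ^ 2 * (x ⬝ᵥ x) := h1
      _ = M' ^ 2 / m ^ 2 * (m ^ 2 * (x ⬝ᵥ x)) := by field_simp
      _ ≤ M' ^ 2 / m ^ 2 * (x ⬝ᵥ P *ᵥ x) := by gcongr
      _ = _ := by field_simp
  · have h1 := quad_le_lambdaMax hP x
    have h2 := lambdaMin_le_quad hP' x
    rw [← hM2] at h1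
    rw [← hm2'] at h2
    calc M' * m' / (m * M) * (x ⬝ᵥ P *ᵥ x) ≤ M' * m' / (m * M) * (M ^ 2 * (x ⬝ᵥ x)) := by gcongr
      _ = M' * M / (m * m') * (m' ^ 2 * (x ⬝ᵥ x)) := by field_simp
      _ ≤ M' * M / (m * m') * (x ⬝ᵥ P' *ᵥ x) := by gcongr
      _ = _ := by ring

/-- Exponential stability of a system that switches between `z' = M z` and, under attack,
`z' = N z`. -/
lemma DoSAttack.exists_exponential_bound [NeZero n] (a : DoSAttack) {η τD κ T : ℝ} (hτD : 0 < τD)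
    (hT : 1 < T) (hfreq : a.FrequencyBound η τD) (hdur : a.DurationBound κ T)
    {P P' M N : Matrix (Fin n) (Fin n) ℝ} (hP : P.PosDef) (hP' : P'.PosDef) {lam σ : ℝ}
    (hlam : 0 < lam) (hσ : 0 < σ)
    (hM : ∀ x, 2 * ((M *ᵥ x) ⬝ᵥ P *ᵥ x) ≤ -(2 * lam + σ) * (x ⬝ᵥ P *ᵥ x))
    (hN : ∀ x, 2 * ((N *ᵥ x) ⬝ᵥ P' *ᵥ x) ≤ lam * (T - 1) * (x ⬝ᵥ P' *ᵥ x))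
    (hτ : Real.log ((lambdaMax P * lambdaMax P') / (lambdaMin P * lambdaMin P'))
      * (T / (2 * (T - 1) * lam)) ≤ τD) :
    ∃ c > 0, ∃ α > 0, ∀ z w : ℝ → Fin n → ℝ, (∀ b, 0 ≤ b → ContinuousOn z (Icc 0 b)) →
      (∀ b, 0 ≤ b → IntervalIntegrable w volume 0 b) →
      (∀ t, 0 ≤ t → z t = z 0 + ∫ s in 0..t, w s) →
      (∀ t, t ∈ a.denied → w t = N *ᵥ z t) → (∀ t, t ∉ a.denied → w t = M *ᵥ z t) →
      ∀ t₀ t, 0 ≤ t₀ → t₀ ≤ t →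
        euclNorm (z t) ≤ c * Real.exp (-α * (t - t₀)) * euclNorm (z t₀) := by
  obtain ⟨c, hc, g, hg, hlog, hg1, hg2⟩ := exists_balancing_weight hP hP'
  obtain ⟨C, hC, hCle⟩ : ∃ C > 0, ∀ x, c * (x ⬝ᵥ P *ᵥ x) ≤ C * euclNorm x ^ 2 ∧
      x ⬝ᵥ P' *ᵥ x ≤ C * euclNorm x ^ 2 := by
    obtain ⟨C, hC, h1⟩ := exists_quad_le P (PosDef.one (n := Fin n) (R := ℝ))
    obtain ⟨C', hC', h2⟩ := exists_quad_le P' (PosDef.one (n := Fin n) (R := ℝ))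
    simp only [one_mulVec, ← euclNorm_sq] at h1 h2
    refine ⟨c * C + C', by positivity, fun x => ⟨?_, ?_⟩⟩
    · calc c * (x ⬝ᵥ P *ᵥ x) ≤ c * (C * euclNorm x ^ 2) := mul_le_mul_of_nonneg_left (h1 x) hc.le
        _ ≤ (c * C + C') * euclNorm x ^ 2 := by
          have : 0 ≤ C' * euclNorm x ^ 2 := by positivity
          linarith
    · refine (h2 x).trans ?_
      have : 0 ≤ c * C * euclNorm x ^ 2 := by positivity
      linarith
  obtain ⟨C', hC', hCge⟩ : ∃ C > 0, ∀ x, euclNorm x ^ 2 ≤ C * (c * (x ⬝ᵥ P *ᵥ x)) ∧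
      euclNorm x ^ 2 ≤ C * (x ⬝ᵥ P' *ᵥ x) := by
    obtain ⟨C, hC, h1⟩ := exists_quad_le 1 hP
    simp only [one_mulVec, ← euclNorm_sq] at h1
    refine ⟨C / c * g, by positivity, fun x => ⟨?_, ?_⟩⟩
    · have : C / c * 1 * (c * (x ⬝ᵥ P *ᵥ x)) ≤ C / c * g * (c * (x ⬝ᵥ P *ᵥ x)) := by
        have := hP.quad_nonneg x
        gcongr
      refine ((h1 x).trans_eq ?_).trans this
      field_simp
    · calc euclNorm x ^ 2 ≤ C * (x ⬝ᵥ P *ᵥ x) := h1 x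
        _ = C / c * (c * (x ⬝ᵥ P *ᵥ x)) := by field_simp
        _ ≤ C / c * (g * (x ⬝ᵥ P' *ᵥ x)) :=
          mul_le_mul_of_nonneg_left (hg2 x) (by positivity)
        _ = _ := by ring
  have hg0 : 0 < g := one_pos.trans_le hg
  have hlogg : 0 ≤ Real.log g := Real.log_nonneg hg
  have hT0 : 0 < T := one_pos.trans hT
  have hT1 : 0 < T - 1 := sub_pos.2 hT
  -- The dwell-time condition, by `hlog`, in the form used below: the mean cost of switching per
  -- unit of time.
  have hrate : Real.log g / τD ≤ lam * (T - 1) / T := by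
    rw [← hlog] at hτ
    rw [div_le_div_iff₀ hτD hT0]
    have h1 : 2 * Real.log g * (T / (2 * (T - 1) * lam)) = Real.log g * T / (lam * (T - 1)) := by
      field_simp
    rw [h1, div_le_iff₀ (by positivity)] at hτ
    linarith
  -- The part of the exponent independent of the elapsed time. Turning a unit of normal time into
  -- attack time costs (2λ + σ) + λ(T - 1) = λ(T + 1) + σ.
  set E : ℝ := η * Real.log g + (lam * (T + 1) + σ) * κ with hE
  -- The energy decays at rate σ(1 - 1/T); the norm decays at half of it.
  set α : ℝ := σ * (1 - 1 / T) / 2 with hα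
  have hαpos : 0 < α := by
    have : 1 / T < 1 := by rwa [div_lt_one hT0]
    have : 0 < 1 - 1 / T := by linarith
    positivity
  -- The summand 1 serves t = t₀, to which the attack bounds do not apply.
  refine ⟨1 + √(C' * Real.exp E * C), by positivity, α, hαpos,
    fun z w hzc hwi hz hwN hwM t₀ t ht₀ ht => ?_⟩
  rcases ht.eq_or_lt with rfl | ht
  · have h1 := euclNorm_nonneg (z t₀)
    have h2 := mul_nonneg (Real.sqrt_nonneg (C' * Real.exp E * C)) h1
    simp only [sub_self, mul_zero, Real.exp_zero, mul_one]
    linarith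
  have hpiece : ∀ r b, 0 ≤ r → r < b → ContinuousOn z (Icc r b) ∧
      ∀ s ∈ Icc r b, z s = z r + ∫ τ in r..s, w τ := fun r b hr hrb => by
    refine ⟨(hzc b (hr.trans hrb.le)).mono (Icc_subset_Icc_left hr), fun s hs => ?_⟩
    rw [hz s (hr.trans hs.1), hz r hr, add_assoc,
      intervalIntegral.integral_add_adjacent_intervals (hwi r hr)
        ((hwi r hr).symm.trans (hwi s (hr.trans hs.1)))]
  let W : Bool → ℝ → ℝ := fun i s =>
    if i then z s ⬝ᵥ P' *ᵥ z s else c * (z s ⬝ᵥ P *ᵥ z s)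
  have htrans : (Ioo t₀ t ∩ frontier a.denied) ⊆ a.transitions t₀ t :=
    inter_subset_inter_left _ Ioo_subset_Icc_self
  obtain ⟨hfin, hcard⟩ := hfreq t₀ t ht₀ ht
  obtain ⟨i, j, hij⟩ := switched_energy_bound (D := a.denied) a.measurableSet_denied (W := W)
    (g := g) (ρ := 2 * lam + σ) (ρ' := lam * (T - 1)) hg0.le
    (by
      have one_le : ∀ r : ℝ, 0 ≤ r → r ≤ g * r := fun r hr => le_mul_of_one_le_left hr hg
      rintro (_ | _) (_ | _) s
      · exact one_le _ (mul_nonneg hc.le (hP.quad_nonneg _))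
      · exact hg2 _
      · exact hg1 _
      · exact one_le _ (hP'.quad_nonneg _))
    (fun r b hr hrb hsub => quad_le_exp_mul_quad hP'.isSymm hN hrb.le (hpiece r b hr hrb).1
      (hpiece r b hr hrb).2 fun s hs => hwN s (hsub hs))
    (fun r b hr hrb hdis => by
      have h1 := quad_le_exp_mul_quad hP.isSymm hM hrb.le (hpiece r b hr hrb).1
        (hpiece r b hr hrb).2 fun s hs => hwM s (disjoint_left.1 hdis hs)
      have h2 := mul_le_mul_of_nonneg_left h1 hc.le
      simp only [W, Bool.false_eq_true, if_false]
      linarith)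
    ht₀ ht (hfin.subset htrans)
  have hcard' : ((Ioo t₀ t ∩ frontier a.denied).ncard : ℝ) ≤ η + (t - t₀) / τD :=
    (Nat.cast_le.2 (ncard_le_ncard htrans hfin)).trans hcard
  set m := volume.real (Ioo t₀ t ∩ a.denied) with hm
  have hm1 : m ≤ κ + (t - t₀) / T := hdur t₀ t ht₀ ht
  have hΔ : 0 < t - t₀ := sub_pos.2 ht
  have hexp : g ^ (Ioo t₀ t ∩ frontier a.denied).ncard *
      Real.exp (-(2 * lam + σ) * ((t - t₀) - m) + lam * (T - 1) * m) ≤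
      Real.exp (E + -(2 * α) * (t - t₀)) := by
    have h1 : g ^ (Ioo t₀ t ∩ frontier a.denied).ncard =
        Real.exp ((Ioo t₀ t ∩ frontier a.denied).ncard * Real.log g) := by
      rw [Real.exp_nat_mul, Real.exp_log hg0]
    rw [h1, ← Real.exp_add, Real.exp_le_exp]
    have h2 := mul_le_mul_of_nonneg_right hcard' hlogg
    have h3 : (t - t₀) / τD * Real.log g ≤ (t - t₀) * (lam * (T - 1) / T) := by
      rw [div_mul_eq_mul_div, mul_div_assoc]
      exact mul_le_mul_of_nonneg_left hrate hΔ.le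
    have h4 := mul_le_mul_of_nonneg_left hm1 (show 0 ≤ lam * (T + 1) + σ by positivity)
    -- The coefficient of λ is (T - 1)/T + (T + 1)/T - 2 = 0.
    have h5 : (t - t₀) * (lam * (T - 1) / T) + (lam * (T + 1) + σ) * ((t - t₀) / T)
        - (2 * lam + σ) * (t - t₀) = -(2 * α) * (t - t₀) := by
      rw [hα]
      field_simp
      ring
    rw [hE]
    linarith
  have hWi : W i t₀ ≤ C * euclNorm (z t₀) ^ 2 := by
    cases i
    · exact (hCle _).1
    · exact (hCle _).2
  have hWj : euclNorm (z t) ^ 2 ≤ C' * W j t := by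
    cases j
    · exact (hCge _).1
    · exact (hCge _).2
  have hsq : euclNorm (z t) ^ 2 ≤
      (√(C' * Real.exp E * C) * Real.exp (-α * (t - t₀)) * euclNorm (z t₀)) ^ 2 := by
    have hWi0 : 0 ≤ W i t₀ := by
      cases i
      · exact mul_nonneg hc.le (hP.quad_nonneg _)
      · exact hP'.quad_nonneg _
    calc euclNorm (z t) ^ 2 ≤ C' * W j t := hWj
      _ ≤ C' * (Real.exp (E + -(2 * α) * (t - t₀)) * (C * euclNorm (z t₀) ^ 2)) := by
        refine mul_le_mul_of_nonneg_left (hij.trans ?_) hC'.le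
        exact mul_le_mul hexp hWi hWi0 (Real.exp_pos _).le
      _ = _ := by
        rw [mul_pow, mul_pow, Real.sq_sqrt (by positivity), Real.exp_add, ← Real.exp_nat_mul]
        push_cast
        rw [show 2 * (-α * (t - t₀)) = -(2 * α) * (t - t₀) by ring]
        ring
  have h0 := euclNorm_nonneg (z t₀)
  have h1 := abs_le_of_sq_le_sq hsq (by positivity)
  refine ((le_abs_self _).trans h1).trans ?_
  gcongr
  linarith

end Resilience

/-! ### The closed loop -/

section ClosedLoop

variable {n q : ℕ}

lemma abs_le_euclNorm (x : Fin n → ℝ) (i : Fin n) : |x i| ≤ euclNorm x := by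
  rw [← Real.sqrt_sq_eq_abs]
  exact Real.sqrt_le_sqrt
    (Finset.single_le_sum (f := fun i => x i ^ 2) (fun j _ => sq_nonneg _) (Finset.mem_univ i))

variable {p : Plant n q} {X : Matrix (Fin n) (Fin q) ℝ} {U : Matrix (Fin 1) (Fin q) ℝ}

/-- The error `x - X v` obeys an unforced switched system. -/
lemma Plant.IsClosedLoop.error_dynamics (a : DoSAttack) {K : Matrix (Fin 1) (Fin n) ℝ}
    (hX : X * p.S = p.A * X + p.B * U + p.D) {x : ℝ → Fin n → ℝ} {v : ℝ → Fin q → ℝ}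
    (h : p.IsClosedLoop (a.controlLaw K (K * X + U) U) x v) :
    ∃ w : ℝ → Fin n → ℝ, (∀ b, 0 ≤ b → ContinuousOn (fun t => x t - X *ᵥ v t) (Icc 0 b)) ∧
      (∀ b, 0 ≤ b → IntervalIntegrable w volume 0 b) ∧
      (∀ t, 0 ≤ t → x t - X *ᵥ v t = x 0 - X *ᵥ v 0 + ∫ s in 0..t, w s) ∧
      (∀ t, t ∈ a.denied → w t = p.A *ᵥ (x t - X *ᵥ v t)) ∧
      (∀ t, t ∉ a.denied → w t = (p.A - p.B * K) *ᵥ (x t - X *ᵥ v t)) := by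
  have htr := fun b (hb : 0 ≤ b) => (h.2 b hb).shift le_rfl hb h.1 X
  -- The disturbance left in the error equation is -B U v. It is cancelled by u = U v under attack,
  -- and otherwise by u = -K x + (K X + U) v = -K(x - X v) + U v.
  have hD : (p.shift X).D = -(p.B * U) := by
    simp only [Plant.shift]
    rw [hX]
    abel
  refine ⟨_, fun b hb => (htr b hb).1, fun b hb =>
    (htr b hb).intervalIntegrable hb (h.1.continuousOn le_rfl),
    fun t ht => (htr t ht).2.2 t (right_mem_Icc.2 ht), fun t ht => ?_, fun t ht => ?_⟩
  · rw [hD, DoSAttack.controlLaw, if_pos ht]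
    simp [Plant.shift, neg_mulVec, mulVec_mulVec]
  · rw [hD, DoSAttack.controlLaw, if_neg ht]
    simp only [Plant.shift, neg_mulVec, mulVec_mulVec, mulVec_add, mulVec_neg, sub_mulVec,
      add_mulVec, mulVec_sub, Matrix.mul_assoc, Matrix.sub_mul]
    abel

/-- Exponential decay of `x - X v` yields output regulation. -/
lemma Plant.achievesOutputRegulation_of_exponential_bound
    {φ : ℝ → (Fin n → ℝ) → (Fin q → ℝ) → Fin 1 → ℝ} (hCX : p.C * X = -p.F)
    (h : ∃ c > 0, ∃ α > 0, ∀ (x : ℝ → Fin n → ℝ) (v : ℝ → Fin q → ℝ), p.IsClosedLoop φ x v →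
      ∀ t₀ t, 0 ≤ t₀ → t₀ ≤ t → euclNorm (x t - X *ᵥ v t) ≤
        c * Real.exp (-α * (t - t₀)) * euclNorm (x t₀ - X *ᵥ v t₀)) :
    p.AchievesOutputRegulation φ := by
  obtain ⟨c, hc, α, hα, h⟩ := h
  refine ⟨⟨c, hc, α, hα, fun x hx t₀ t ht₀ ht => ?_⟩, fun x v hxv => ?_⟩
  · simpa using h x _ hx t₀ t ht₀ ht
  · have hexp : Tendsto (fun t : ℝ => c * Real.exp (-α * (t - 0)) * euclNorm (x 0 - X *ᵥ v 0))
        atTop (𝓝 0) := by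
      have h1 : Tendsto (fun t : ℝ => -α * (t - 0)) atTop atBot := by
        simpa using tendsto_id.const_mul_atTop_of_neg (neg_neg_of_pos hα)
      simpa using ((Real.tendsto_exp_atBot.comp h1).const_mul c).mul_const
        (euclNorm (x 0 - X *ᵥ v 0))
    have hz : Tendsto (fun t => x t - X *ᵥ v t) atTop (𝓝 0) := by
      refine tendsto_pi_nhds.2 fun i => squeeze_zero_norm' ?_ hexp
      filter_upwards [eventually_ge_atTop 0] with t ht
      exact (abs_le_euclNorm _ i).trans (h x v hxv 0 t le_rfl ht)
    have hC : Tendsto (fun t => p.C *ᵥ (x t - X *ᵥ v t)) atTop (𝓝 (p.C *ᵥ 0)) :=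
      ((by fun_prop : Continuous fun y : Fin n → ℝ => p.C *ᵥ y).tendsto 0).comp hz
    rw [mulVec_zero] at hC
    refine hC.congr fun t => ?_
    -- Since C X = -F, the tracking error is C(x - X v).
    rw [mulVec_sub, mulVec_mulVec, hCX, neg_mulVec, sub_neg_eq_add]

end ClosedLoop

end ResilientRegulation
open ResilientRegulation in
theorem theorem1 {n q : ℕ} (p : Plant n q)
    (hctrl : IsControllable p.A p.B) (hreg : p.RegulatorRankCondition)
    -- the attack: frequency and duration assumptions
    (a : DoSAttack) (η τD κ T : ℝ) (hη : 1 < η) (hτD : 0 < τD) (hκ : 0 < κ) (hT : 1 < T)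
    (hfreq : a.FrequencyBound η τD) (hdur : a.DurationBound κ T)
    -- the learning data
    (d : Experiment n q) (hd : d.IsGeneratedBy p)
    (Xt : ℕ → Matrix (Fin n) (Fin q) ℝ) (hXt : IsTrialFamily p Xt)
    (hrich : ∀ i ≤ (n - 1) * q + 1, d.IsRichFor (Xt i))
    -- first phase: growth rate of the uncontrolled plant
    (ε lamP : ℝ) (hε : 0 < ε) (hlamP : 0 < lamP) (Pp : Matrix (Fin n) (Fin n) ℝ)
    (hPp : IsLearnedGrowth d ε lamP Pp)
    -- second phase: policy iteration with the convergence rate `lamM`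
    (lamM : ℝ) (hlamM : lamM = 2 * lamP / (T - 1))
    (Q : Matrix (Fin n) (Fin n) ℝ) (hQ : Q.PosDef)
    (kstar : ℕ) (P : ℕ → Matrix (Fin n) (Fin n) ℝ) (K : ℕ → Matrix (Fin 1) (Fin n) ℝ)
    (hPI : IsPolicyIteration p d Q lamM kstar P K)
    -- last phase: solution of the regulator equations
    (X : Matrix (Fin n) (Fin q) ℝ) (U : Matrix (Fin 1) (Fin q) ℝ)
    (hXU : IsLearnedRegulator d Q lamM Xt (P kstar) (K kstar) (K (kstar + 1)) X U)
    -- the iteration whose controller is used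
    (k : ℕ) (hk : 0 < k) (hkstar : k ≤ kstar)
    (hτ : Real.log ((lambdaMax (P k) * lambdaMax Pp) / (lambdaMin (P k) * lambdaMin Pp))
      * (T / (2 * (T - 1) * lamM)) ≤ τD) :
    p.AchievesOutputRegulation (a.controlLaw (K k) (K k * X + U) U) ∧
    ∃ c > 0, ∃ α > 0, ∀ (x : ℝ → Fin n → ℝ) (v : ℝ → Fin q → ℝ),
      p.IsClosedLoop (a.controlLaw (K k) (K k * X + U) U) x v →
      ∀ t₀ t, 0 ≤ t₀ → t₀ ≤ t →
        euclNorm (x t - X.mulVec (v t))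
          ≤ c * Real.exp (-α * (t - t₀)) * euclNorm (x t₀ - X.mulVec (v t₀)) := by
  have hr0 : d.IsRichFor 0 := hXt.zero ▸ hrich 0 (Nat.zero_le _)
  have hPk : (P k).PosDef := hPI.posDef hd hr0 hQ hkstar
  have hX : X * p.S = p.A * X + p.B * U + p.D :=
    hXU.sylvester_eq hXt hd hrich hQ (hPI.posDef hd hr0 hQ le_rfl)
  have hlam : 0 < lamM := by
    rw [hlamM]
    exact div_pos (by positivity) (sub_pos.2 hT)
  -- This choice of λ⁻ expresses the growth rate under attack in terms of λ⁻, so that it can be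
  -- balanced against the decay.
  have hlamP' : 2 * lamP = lamM * (T - 1) := by
    rw [hlamM, div_mul_cancel₀ _ (sub_pos.2 hT).ne']
  have hbound : ∃ c > 0, ∃ α > 0, ∀ (x : ℝ → Fin n → ℝ) (v : ℝ → Fin q → ℝ),
      p.IsClosedLoop (a.controlLaw (K k) (K k * X + U) U) x v →
      ∀ t₀ t, 0 ≤ t₀ → t₀ ≤ t → euclNorm (x t - X.mulVec (v t)) ≤
        c * Real.exp (-α * (t - t₀)) * euclNorm (x t₀ - X.mulVec (v t₀)) := by
    -- With an empty state all norms vanish, whereas the extreme eigenvalues are meaningless.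
    rcases Nat.eq_zero_or_pos n with rfl | hn
    · exact ⟨1, one_pos, 1, one_pos, fun x v _ t₀ t _ _ => by simp [euclNorm]⟩
    have : NeZero n := ⟨hn.ne'⟩
    -- P_k ≤ r Q, so r⁻¹ is the margin σ by which the decay rate exceeds 2λ⁻.
    obtain ⟨r, hr, hrQ⟩ := exists_quad_le (P k) hQ
    obtain ⟨G, Z, hGZ⟩ := hPp.solves
    have hM : ∀ x, 2 * (((p.A - p.B * K k) *ᵥ x) ⬝ᵥ P k *ᵥ x) ≤
        -(2 * lamM + r⁻¹) * (x ⬝ᵥ P k *ᵥ x) := fun x => by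
      have h1 := quad_lyapunov hPk.isSymm (p.A - p.B * K k + lamM • 1) x
      rw [hPI.evaluation hd hr0 hQ hkstar, neg_mulVec, dotProduct_neg, add_mulVec, dotProduct_add,
        add_mulVec, add_dotProduct, smul_mulVec, one_mulVec, smul_dotProduct, smul_eq_mul,
        ← mulVec_mulVec, dotProduct_mulVec x (K k)ᵀ, vecMul_transpose, ← euclNorm_sq] at h1
      have h2 : r⁻¹ * (x ⬝ᵥ P k *ᵥ x) ≤ x ⬝ᵥ Q *ᵥ x := by
        rw [inv_mul_le_iff₀ hr]
        exact hrQ x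
      have h3 := sq_nonneg (euclNorm (K k *ᵥ x))
      linarith
    have hN : ∀ x, 2 * ((p.A *ᵥ x) ⬝ᵥ Pp *ᵥ x) ≤ lamM * (T - 1) * (x ⬝ᵥ Pp *ᵥ x) := fun x => by
      have h1 := quad_lyapunov hPp.posDef.isSymm p.A x
      rw [hr0.of_growth_regression hd hPp.posDef.isSymm hGZ, hlamP', sub_mulVec, dotProduct_sub,
        smul_mulVec, smul_mulVec, one_mulVec, dotProduct_smul, dotProduct_smul, smul_eq_mul,
        smul_eq_mul, ← euclNorm_sq] at h1
      have h2 := mul_nonneg hε.le (sq_nonneg (euclNorm x))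
      linarith
    obtain ⟨c, hc, α, hα, h⟩ := a.exists_exponential_bound hτD hT hfreq hdur hPk hPp.posDef hlam
      (inv_pos.2 hr) hM hN hτ
    refine ⟨c, hc, α, hα, fun x v hxv => ?_⟩
    obtain ⟨w, h1, h2, h3, h4, h5⟩ := hxv.error_dynamics a hX
    exact h _ w h1 h2 h3 h4 h5
  exact ⟨p.achievesOutputRegulation_of_exponential_bound (hXU.output_eq hXt) hbound, hbound⟩
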